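/- Let $m\ge 1$ and let $\widetilde\Sigma=\{F_1,\dots,F_M\}\subset\mathbb C[y,y',\dots,y^{(m)}]$ be a finite system of autonomous algebraic differential equations $F_j(y,y',\dots,y^{(m)})=0$. Assume that the algebraic set $\mathbb V_{\mathbb C}(\widetilde\Sigma)\subset\mathbb C^{m+1}$, where $y,y',\dots,y^{(m)}$ are regarded as independent variables, has dimension one. **Reduced differential equation.** Order the variables by $y<y'<\dots<y^{(m)}$. A *regular chain* is a finite sequence $T$ of non-constant polynomials with strictly increasing leading variables such that for every $F\in T$ the initial $\operatorname{init}(F)$ (the leading coefficient of $F$ in its leading variable) has non-zero iterated resultant with $T$ (first with the last polynomial of $T$, finally with the first one, each time with respect to the leading variable). A *regular chain decomposition* of $\widetilde\Sigma$ is a finite family of regular chains $T_1,\dots,T_N$ such that, for every field $K\supseteq\mathbb C$, $\mathbb V_K(\widetilde\Sigma)=\bigcup_k \mathbb V_K(T_k)\setminus\mathbb V_K\big(\prod_{F\in T_k}\operatorname{init}(F)\big)$. Among its members consider those of the form $G_1(y,y'),G_2(y,y',y''),\dots,G_m(y,\dots,y^{(m)})$, where $G_j$ has leading variable $y^{(j)}$.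 For each of them let $g\in\mathbb C[u_0,u_1]$ be obtained from the square-free part of $G_1(u_0,u_1)$ by * (a) removing all factors in $\mathbb C[u_0]$, or * (b) removing all factors in $\mathbb C[u_0]$ and all factors in $\mathbb C[u_1]$ (one of the two conventions is fixed for all chains). For $j\ge2$ write the $(j-1)$-st total derivative of $g(y,y')$ as $\frac{\partial g}{\partial u_1}(y,y')\,y^{(j)}+R_{j-1}(y,\dots,y^{(j-1)})$. Put $B_0=u_0$, $B_1=u_1$ and recursively $B_j=-R_{j-1}(B_0,\dots,B_{j-1})/\frac{\partial g}{\partial u_1}\in\mathbb C(u_0,u_1)$ for $2\le j\le m$ (if $g$ is a constant, which is possible only under (b), the $B_j$ may be chosen arbitrarily). Let $H_1=g$, let $H_j$ for $2\le j\le m$ be the numerator of $G_j(u_0,u_1,B_2,\dots,B_j)$, and take $\gcd(H_1,\dots,H_m)$. The least common multiple $H(y,y')\in\mathbb C[y,y']$ of these gcd's over all chains of the above form (with $H=1$ if there is none) is called a *reduced differential equation* of $\widetilde\Sigma$; it depends on the decomposition and on the convention. **Theorem.** Let $H$ be a reduced differential equation of $\widetilde\Sigma$, and let $y(x)$ be a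 non-constant formal Puiseux series solution of $\widetilde\Sigma$, expanded around some $x_0\in\mathbb C\cup\{\infty\}$, that is algebraic over $\mathbb C(x)$. If $H$ is formed with convention (b), assume in addition that $y(x)$ is not of the form $\alpha x+\beta$ with $\alpha,\beta\in\mathbb C$. Then $y(x)$ has a minimal polynomial, i.e. an irreducible $G(x,Y)\in\mathbb C[x,Y]$ with $G(x,y(x))=0$, and every such $G$ satisfies $$\deg_x G\le\deg_{y'}H\qquad\text{and}\qquad \deg_Y G\le\deg_y H+\deg_{y'}H .$$ In particular, if $y(x)$ is the expansion of a rational function, then its degree, the maximum of the degrees of its numerator and denominator in lowest terms, is at most $\deg_{y'}H$. -/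

import Mathlib

open MvPolynomial

noncomputable section

namespace AutonomousODE

/-! ## Triangular systems and regular chains in `ℂ[y₀, …, y_m]`, ordered by `y₀ < ⋯ < y_m` -/

section Chains

variable {m : ℕ}

/-- The index of the leading variable of a non-constant polynomial. -/
def lv (F : MvPolynomial (Fin (m + 1)) ℂ) : Fin (m + 1) := F.vars.sup id

/-- `F` regarded as a univariate polynomial in the variable `y_i`; the coefficients
lie in the same polynomial ring and do not involve `y_i`. -/
def asPoly (i : Fin (m + 1)) :
    MvPolynomial (Fin (m + 1)) ℂ →ₐ[ℂ] Polynomial (MvPolynomial (Fin (m + 1)) ℂ) :=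
  aeval fun k => if k = i then Polynomial.X else Polynomial.C (X k)

/-- The initial: the leading coefficient with respect to the leading variable. -/
def initial (F : MvPolynomial (Fin (m + 1)) ℂ) : MvPolynomial (Fin (m + 1)) ℂ :=
  (asPoly (lv F) F).leadingCoeff

/-- The resultant of `f` and `g` with respect to the variable `y_i`. -/
def resVar (i : Fin (m + 1)) (f g : MvPolynomial (Fin (m + 1)) ℂ) :
    MvPolynomial (Fin (m + 1)) ℂ :=
  Polynomial.resultant (asPoly i f) (asPoly i g)

/-- The iterated resultant `Res(f, [F₁, …, F_M])`: first with `F_M`, lastly with `F₁`, each time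
with respect to the leading variable. -/
def resChain (f : MvPolynomial (Fin (m + 1)) ℂ) (T : List (MvPolynomial (Fin (m + 1)) ℂ)) :
    MvPolynomial (Fin (m + 1)) ℂ :=
  T.foldr (fun F r => resVar (lv F) r F) f

/-- A regular chain: a finite sequence of non-constant polynomials with strictly increasing
leading variables, such that no initial has vanishing iterated resultant with the chain. -/
structure IsRegularChain (T : List (MvPolynomial (Fin (m + 1)) ℂ)) : Prop where
  nonconstant : ∀ F ∈ T, F.vars.Nonempty
  triangular : T.Pairwise fun F G => lv F < lv G
  regular : ∀ F ∈ T, resChain (initial F) T ≠ 0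

/-- The zero set of a family of polynomials in `K^(m+1)`. -/
def zeroSet (K : Type) [Field K] [Algebra ℂ K] (S : Set (MvPolynomial (Fin (m + 1)) ℂ)) :
    Set (Fin (m + 1) → K) :=
  {a | ∀ F ∈ S, aeval a F = 0}

/-- `T₁, …, T_N` is a regular chain decomposition of the system `S`: each `T_k` is a regular
chain and, over every field `K ⊇ ℂ`, the zero set of `S` is the union of the sets of those zeros
of `T_k` at which the product of the initials of `T_k` does not vanish. -/
def IsRegularChainDecomposition (S : Set (MvPolynomial (Fin (m + 1)) ℂ)) {N : ℕ}
    (T : Fin N → List (MvPolynomial (Fin (m + 1)) ℂ)) : Prop :=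
  (∀ k, IsRegularChain (T k)) ∧
  ∀ (K : Type) [Field K] [Algebra ℂ K],
    zeroSet K S = ⋃ k, zeroSet K {F | F ∈ T k} \ zeroSet K {((T k).map initial).prod}

/-- The dimension of the algebraic set `V_ℂ(S)`: the Krull dimension of its coordinate ring. -/
def dimension (S : Set (MvPolynomial (Fin (m + 1)) ℂ)) : WithBot ℕ∞ :=
  ringKrullDim
    (MvPolynomial (Fin (m + 1)) ℂ ⧸ vanishingIdeal ℂ (zeroLocus ℂ (Ideal.span S)))

end Chains

/-! ## The reduced differential equation -/

/-- The total derivative on differential polynomials: `y^(i) ↦ y^(i+1)`. -/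
def totalDeriv : Derivation ℂ (MvPolynomial ℕ ℂ) (MvPolynomial ℕ ℂ) :=
  mkDerivation ℂ fun i => X (i + 1)

/-- The field `ℂ(u₀, u₁)`. -/
abbrev RatUV : Type := FractionRing (MvPolynomial (Fin 2) ℂ)

/-- The separant `∂g/∂u₁`. -/
def separant (g : MvPolynomial (Fin 2) ℂ) : MvPolynomial (Fin 2) ℂ := pderiv 1 g

/-- The differential polynomial `R_(j-1) = g^(j-1) - (∂g/∂u₁)(y, y') y^(j)`; for `j ≥ 2` it has
order at most `j - 1`. -/
def rittRem (g : MvPolynomial (Fin 2) ℂ) (j : ℕ) : MvPolynomial ℕ ℂ :=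
  totalDeriv^[j - 1] (rename Fin.val g) - rename Fin.val (separant g) * X j

/-- `B₀ = u₀`, `B₁ = u₁` and `B_j = -R_(j-1)(B₀, …, B_(j-1)) / (∂g/∂u₁)` for `j ≥ 2`.
(Variables of index at least `j` do not occur in `R_(j-1)`, so the value assigned to them
is irrelevant.) -/
def ratB (g : MvPolynomial (Fin 2) ℂ) : ℕ → RatUV
  | 0 => algebraMap _ _ (X 0 : MvPolynomial (Fin 2) ℂ)
  | 1 => algebraMap _ _ (X 1 : MvPolynomial (Fin 2) ℂ)
  | n + 2 =>
      -(aeval (fun i => if _h : i < n + 2 then ratB g i else 0) (rittRem g (n + 2))) /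
        algebraMap _ _ (separant g)
termination_by n => n

section Reduced

variable {m : ℕ}

/-- A polynomial of `ℂ[y₀, …, y_m]` in which only `y₀` and `y₁` occur, regarded as an element
of `ℂ[u₀, u₁]`. -/
def toBiv : MvPolynomial (Fin (m + 1)) ℂ →ₐ[ℂ] MvPolynomial (Fin 2) ℂ :=
  aeval fun i => if h : (i : ℕ) < 2 then X ⟨i, h⟩ else 0

/-- `g` is, up to a constant factor, the square-free part of `p` after removing the factors in
`ℂ[u₀]` and, if `strip = true`, also those in `ℂ[u₁]`. -/
def IsStartingPart (strip : Bool) (p g : MvPolynomial (Fin 2) ℂ) : Prop :=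
  Squarefree g ∧ ∀ P : MvPolynomial (Fin 2) ℂ, Irreducible P →
    (P ∣ g ↔ P ∣ p ∧ P.degreeOf 1 ≠ 0 ∧ (strip = true → P.degreeOf 0 ≠ 0))

/-- `H` is a greatest common divisor of the family `f`. -/
def IsGCDOf {ι : Type} (f : ι → MvPolynomial (Fin 2) ℂ) (H : MvPolynomial (Fin 2) ℂ) : Prop :=
  (∀ i, H ∣ f i) ∧ ∀ D, (∀ i, D ∣ f i) → D ∣ H

/-- `H` is a least common multiple of the polynomials `f i` with `p i`. -/
def IsLCMOf {ι : Type} (p : ι → Prop) (f : ι → MvPolynomial (Fin 2) ℂ)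
    (H : MvPolynomial (Fin 2) ℂ) : Prop :=
  (∀ i, p i → f i ∣ H) ∧ ∀ D, (∀ i, p i → f i ∣ D) → H ∣ D

/-- The chain `T` consists of `G₁, …, G_m` (here `G 0, …, G (m - 1)`), where `G_j` has leading
variable `y^(j)`. -/
def IsODEChain (T : List (MvPolynomial (Fin (m + 1)) ℂ))
    (G : Fin m → MvPolynomial (Fin (m + 1)) ℂ) : Prop :=
  T = List.ofFn G ∧ ∀ j, (G j).vars.Nonempty ∧ lv (G j) = j.succ

/-- The polynomials `H₁, …, H_m ∈ ℂ[u₀, u₁]` associated with `g, G₂, …, G_m`, where `g` takes the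
place of `G₁`: the numerators of `g(u₀, u₁)` and of `G_j(u₀, u₁, B₂, …, B_j)` for `j ≥ 2`. -/
def assocPoly (g : MvPolynomial (Fin 2) ℂ) (G : Fin m → MvPolynomial (Fin (m + 1)) ℂ)
    (j : Fin m) : MvPolynomial (Fin 2) ℂ :=
  IsFractionRing.num (MvPolynomial (Fin 2) ℂ)
    (if (j : ℕ) = 0 then algebraMap (MvPolynomial (Fin 2) ℂ) RatUV g
      else aeval (fun i : Fin (m + 1) => ratB g i) (G j))

/-- `h` is a reduced differential equation of the chain `G₁, …, G_m`. -/
def IsReducedOfChain [NeZero m] (strip : Bool) (G : Fin m → MvPolynomial (Fin (m + 1)) ℂ)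
    (h : MvPolynomial (Fin 2) ℂ) : Prop :=
  ∃ g, IsStartingPart strip (toBiv (G 0)) g ∧ IsGCDOf (assocPoly g G) h

/-- `H` is a reduced differential equation of the system `S`: a least common multiple of the
reduced differential equations `h k` of those chains of a regular chain decomposition of `S`
that have the form `G₁(y, y'), G₂(y, y', y''), …, G_m(y, …, y^(m))`. -/
def IsReducedEquation [NeZero m] (strip : Bool) (S : Set (MvPolynomial (Fin (m + 1)) ℂ))
    (H : MvPolynomial (Fin 2) ℂ) : Prop :=
  ∃ (N : ℕ) (T : Fin N → List (MvPolynomial (Fin (m + 1)) ℂ))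
    (h : Fin N → MvPolynomial (Fin 2) ℂ),
    IsRegularChainDecomposition S T ∧
    (∀ k G, IsODEChain (T k) G → IsReducedOfChain strip G (h k)) ∧
    IsLCMOf (fun k => ∃ G, IsODEChain (T k) G) h H

end Reduced

/-! ## Formal Puiseux series expanded around a point of `ℂ ∪ {∞}` -/

/-- A Hahn series `∑ c_q t^q` with rational exponents is a Puiseux series if its exponents have a
common denominator. Here `t = x - x₀` for a finite expansion point, and `t = 1/x` at infinity. -/
def IsPuiseux (y : HahnSeries ℚ ℂ) : Prop :=
  ∃ n : ℕ, 0 < n ∧ ∀ q ∈ y.support, ∃ z : ℤ, q = z / n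

/-- The operator `t d/dt`. -/
def euler (y : HahnSeries ℚ ℂ) : HahnSeries ℚ ℂ where
  coeff q := (q : ℂ) * y.coeff q
  isPWO_support' := y.isPWO_support.mono fun _ hq => right_ne_zero_of_mul hq

/-- The expansion of the independent variable `x` around `x₀`. -/
def xSeries : OnePoint ℂ → HahnSeries ℚ ℂ
  | none => HahnSeries.single (-1) 1
  | some x₀ => HahnSeries.C x₀ + HahnSeries.single 1 1

/-- The derivation `d/dx` on series expanded around `x₀`: it is `d/dt = t⁻¹ (t d/dt)` if `x₀` is
finite and `-t² d/dt = -t (t d/dt)` at infinity. -/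
def ddx : OnePoint ℂ → HahnSeries ℚ ℂ → HahnSeries ℚ ℂ
  | none => fun y => -(HahnSeries.single 1 1 * euler y)
  | some _ => fun y => HahnSeries.single (-1) 1 * euler y

/-- `y` solves all the equations `F(y, y', …, y^(m)) = 0`, `F ∈ S`. -/
def IsSolution {m : ℕ} (S : Set (MvPolynomial (Fin (m + 1)) ℂ)) (x₀ : OnePoint ℂ)
    (y : HahnSeries ℚ ℂ) : Prop :=
  ∀ F ∈ S, aeval (fun i : Fin (m + 1) => (ddx x₀)^[i] y) F = 0

/-- `y` is algebraic over `ℂ(x)`. -/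
def IsAlgebraicSeries (x₀ : OnePoint ℂ) (y : HahnSeries ℚ ℂ) : Prop :=
  IsAlgebraic (IntermediateField.adjoin ℂ {xSeries x₀}) y

/-- `G(x, Y)` (with `x` the variable `0` and `Y` the variable `1`) is a minimal polynomial of
`y(x)` over `ℂ[x]`: it is irreducible in `ℂ[x, Y]` and `G(x, y(x)) = 0`. -/
def IsMinimalPolynomial (x₀ : OnePoint ℂ) (y : HahnSeries ℚ ℂ)
    (G : MvPolynomial (Fin 2) ℂ) : Prop :=
  Irreducible G ∧ aeval ![xSeries x₀, y] G = 0

/-- `y` is the expansion around `x₀` of the rational function `r`. -/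
def IsExpansionOf (x₀ : OnePoint ℂ) (y : HahnSeries ℚ ℂ) (r : RatFunc ℂ) : Prop :=
  y = Polynomial.aeval (xSeries x₀) r.num / Polynomial.aeval (xSeries x₀) r.denom

end AutonomousODE

end

open MvPolynomial

noncomputable section

namespace AutonomousODE

/-! ## The field of Hahn series with rational exponents is algebraically closed -/

section AlgClosed

open HahnSeries

/-! The proof finds an irreducible `P` with `P(y, y') = 0` that divides `H`, and then bounds the
degrees of `G` by those of `P`.

Divisibility (`IsReducedEquation.exists_dvd`). The point `(y, y', …, y^(m))` over the field of Hahn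
series is a zero of the system, hence of some chain of the decomposition. As `y` is transcendental
over `ℂ`, no polynomial of that chain has leading variable `y`. Were a further variable not leading,
a generic zero of the chain would have two algebraically independent coordinates
(`IsRegularChain.exists_generic_zero`) and the system would have dimension at least two. So the
chain is `G₁(y, y'), …, G_m`. Take for `P` the irreducible factor of `G₁` that vanishes at `(y,
y')`. It survives in `g`, because `y` is transcendental and, under convention (b), so is `y'`. The
separant of the square-free `g` does not vanish at `(y, y')`, so `B_j` takes there the value `y^(j)`
(`hasValueAt_ratB`). Every `H_j` thus vanishes at `(y, y')` and is divisible by `P`, and so is `H`.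

Degrees (`degree_bounds`). Put `L = ℂ(x, y)`. The subfield `ℂ(y, y')` is closed under `d/dx`, and
`x` is algebraic over it with `x' = 1`. As all constants are complex, `x` lies in it, so `ℂ(y, y') =
L`. Hence `deg_x G = [L : ℂ(y)] = deg_{y'} P`. For `deg_Y G = [L : ℂ(x)]`, the number of poles of
`x`, note that a pole of `x` is a pole of `y` or a zero of `y'`; so it is at most `[L : ℂ(y)] + [L :
ℂ(y')] = deg_{y'} P + deg_y P` (`finrank_adjoin_x_le`). The places over `x = ∞` are represented by
the embeddings of `L` over `ℂ(x)` into Hahn series in `1/x`. There are `[L : ℂ(x)]` of them because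
the field of Hahn series is algebraically closed, which is proved by extending the order valuation
to an algebraic closure. -/

lemma orderTop_mul_eq (a b : HahnSeries ℚ ℂ) : (a * b).orderTop = a.orderTop + b.orderTop := by
  simpa only [addVal_apply] using (addVal ℚ ℂ).map_mul a b

lemma orderTop_add_nonneg {a b : HahnSeries ℚ ℂ} (ha : 0 ≤ a.orderTop) (hb : 0 ≤ b.orderTop) :
    0 ≤ (a + b).orderTop :=
  (le_min ha hb).trans min_orderTop_le_orderTop_add

lemma order_inv_eq {a : HahnSeries ℚ ℂ} (ha : a ≠ 0) : a⁻¹.order = -a.order := by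
  have h := order_mul ha (inv_ne_zero ha)
  rw [mul_inv_cancel₀ ha, order_one] at h
  linarith

/-- The ring of Hahn series without negative exponents. -/
def hahnIntegers : ValuationSubring (HahnSeries ℚ ℂ) where
  carrier := {a | 0 ≤ a.orderTop}
  mul_mem' {a b} ha hb := by
    simp only [Set.mem_ofPred_eq] at *
    rw [orderTop_mul_eq]
    exact add_nonneg ha hb
  one_mem' := by simp
  add_mem' ha hb := orderTop_add_nonneg ha hb
  zero_mem' := by simp
  neg_mem' {a} ha := by simpa using ha
  mem_or_inv_mem' a := by
    by_cases ha : a = 0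
    · simp [ha]
    · simp only [Set.mem_ofPred_eq, zero_le_orderTop_iff, order_inv_eq ha]
      rcases le_total 0 a.order with h | h
      · exact Or.inl h
      · exact Or.inr (by linarith)

variable {Ω : Type*} [Field Ω] [Algebra (HahnSeries ℚ ℂ) Ω]

/-- The image of the local ring of series of non-negative order is dominated by a valuation ring of
`Ω`. Domination keeps non-units non-units: a series of positive order has no inverse of non-negative
order. -/
lemma exists_valuationSubring_dominating :
    ∃ V : ValuationSubring Ω,
      (∀ a : HahnSeries ℚ ℂ, 0 ≤ a.orderTop → V.valuation (algebraMap _ Ω a) ≤ 1) ∧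
      (∀ a : HahnSeries ℚ ℂ, 0 < a.orderTop → V.valuation (algebraMap _ Ω a) < 1) := by
  obtain ⟨V, hle, hloc⟩ := LocalSubring.exists_le_valuationSubring
    (hahnIntegers.toLocalSubring.map (algebraMap (HahnSeries ℚ ℂ) Ω))
  have hmem : ∀ a : HahnSeries ℚ ℂ, 0 ≤ a.orderTop → algebraMap _ Ω a ∈ V := fun a ha =>
    hle ⟨a, ha, rfl⟩
  refine ⟨V, fun a ha => (V.valuation_le_one_iff _).2 (hmem a ha), fun a ha => ?_⟩
  refine lt_of_le_of_ne ((V.valuation_le_one_iff _).2 (hmem a ha.le)) fun h1 => ?_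
  have hu : IsUnit (⟨_, hmem a ha.le⟩ : V) := (V.valuation_eq_one_iff _).2 h1
  let a' : (hahnIntegers.toLocalSubring.map (algebraMap (HahnSeries ℚ ℂ) Ω)).toSubring :=
    ⟨algebraMap _ Ω a, ⟨a, ha.le, rfl⟩⟩
  have hu' : IsUnit a' := hloc.map_nonunit a' hu
  obtain ⟨⟨b', b, hb, hbb⟩, hab⟩ := isUnit_iff_exists_inv.1 hu'
  have hab' : algebraMap _ Ω a * algebraMap _ Ω b = 1 := by
    have := congrArg Subtype.val hab
    simp only [a', Subring.coe_mul, Subring.coe_one] at this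
    rw [← this, ← hbb]
  rw [← map_mul, ← map_one (algebraMap (HahnSeries ℚ ℂ) Ω)] at hab'
  have h := congrArg orderTop ((algebraMap (HahnSeries ℚ ℂ) Ω).injective hab')
  rw [orderTop_mul_eq, orderTop_one] at h
  have hb' : 0 ≤ b.orderTop := hb
  have : 0 < a.orderTop + b.orderTop := add_pos_of_pos_of_nonneg ha hb'
  exact this.ne' h

variable (Ω) in
/-- The power `t ^ q` in an extension field. -/
abbrev tPow (q : ℚ) : Ω := algebraMap (HahnSeries ℚ ℂ) Ω (single q 1)

lemma tPow_ne_zero (q : ℚ) : tPow Ω q ≠ 0 := by simp [tPow]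

lemma tPow_add (p q : ℚ) : tPow Ω (p + q) = tPow Ω p * tPow Ω q := by
  simp [tPow, ← map_mul]

lemma tPow_mul_natCast (q : ℚ) (n : ℕ) : tPow Ω (q * n) = tPow Ω q ^ n := by
  rw [tPow, tPow, ← map_pow, single_pow, one_pow, nsmul_eq_mul, mul_comm]

/-- The two conditions force the valuation of `V` to restrict to the order on Hahn series, see
`Dominates.lt_tPow_iff`. -/
structure Dominates (V : ValuationSubring Ω) : Prop where
  le_one : ∀ a : HahnSeries ℚ ℂ, 0 ≤ a.orderTop → V.valuation (algebraMap _ Ω a) ≤ 1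
  lt_one : ∀ a : HahnSeries ℚ ℂ, 0 < a.orderTop → V.valuation (algebraMap _ Ω a) < 1

variable {V : ValuationSubring Ω}

lemma Dominates.eq_one (hV : Dominates V) {a : HahnSeries ℚ ℂ} (ha : a ≠ 0) (h : a.order = 0) :
    V.valuation (algebraMap _ Ω a) = 1 := by
  refine le_antisymm (hV.le_one a (zero_le_orderTop_iff.2 h.ge)) ?_
  have h1 := hV.le_one a⁻¹ (zero_le_orderTop_iff.2 (by rw [order_inv_eq ha, h, neg_zero]))
  rw [map_inv₀, map_inv₀] at h1
  have h0 : V.valuation (algebraMap _ Ω a) ≠ 0 := by simpa using ha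
  exact (inv_le_one₀ (zero_lt_iff.2 h0)).1 h1

lemma Dominates.eq_tPow_order (hV : Dominates V) {a : HahnSeries ℚ ℂ} (ha : a ≠ 0) :
    V.valuation (algebraMap _ Ω a) = V.valuation (tPow Ω a.order) := by
  have h0 : single (-a.order) (1 : ℂ) ≠ 0 := by simp
  have h := hV.eq_one (mul_ne_zero ha h0) (by rw [order_mul ha h0, order_single one_ne_zero]; simp)
  have h2 : tPow Ω a.order * tPow Ω (-a.order) = 1 := by
    rw [← tPow_add, add_neg_cancel, tPow, ← map_one (algebraMap (HahnSeries ℚ ℂ) Ω)]; rfl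
  have h3 : algebraMap _ Ω a = algebraMap _ Ω (a * single (-a.order) (1 : ℂ)) * tPow Ω a.order := by
    rw [map_mul, mul_assoc, mul_comm _ (tPow Ω a.order), h2, mul_one]
  rw [h3, map_mul, h, one_mul]

lemma Dominates.lt_tPow_iff (hV : Dominates V) (a : HahnSeries ℚ ℂ) (q : ℚ) :
    V.valuation (algebraMap _ Ω a) < V.valuation (tPow Ω q) ↔ q < a.orderTop := by
  have hmono : ∀ p q : ℚ, p < q → V.valuation (tPow Ω q) < V.valuation (tPow Ω p) := by
    intro p q hpq
    have h := hV.lt_one (single (q - p) 1) (by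
      rw [orderTop_single one_ne_zero]; exact_mod_cast sub_pos.2 hpq)
    have h2 : tPow Ω q = tPow Ω (q - p) * tPow Ω p := by rw [← tPow_add, sub_add_cancel]
    rw [h2, map_mul]
    have h0 : V.valuation (tPow Ω p) ≠ 0 := by simp
    exact mul_lt_of_lt_one_left (zero_lt_iff.2 h0) h
  by_cases ha : a = 0
  · simp [ha, zero_lt_iff]
  · rw [hV.eq_tPow_order ha, ← order_eq_orderTop_of_ne_zero ha, WithTop.coe_lt_coe]
    refine ⟨fun h => ?_, fun h => hmono _ _ h⟩
    by_contra hc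
    rcases (not_lt.1 hc).lt_or_eq with h1 | h1
    · exact (h.trans (hmono _ _ h1)).false
    · rw [h1] at h; exact h.false

omit [Algebra (HahnSeries ℚ ℂ) Ω] in
-- Ultrametric principle: a single term of largest valuation could not be cancelled.
lemma exists_ne_valuation_eq_of_sum_eq_zero {n : ℕ} (f : ℕ → Ω) (i₀ : ℕ) (hi₀ : i₀ < n)
    (hf : f i₀ ≠ 0) (hsum : ∑ i ∈ Finset.range n, f i = 0) :
    ∃ i j, i < j ∧ f i ≠ 0 ∧ f j ≠ 0 ∧ V.valuation (f i) = V.valuation (f j) := by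
  obtain ⟨j, hj, hmax⟩ := Finset.exists_max_image (Finset.range n) (fun i => V.valuation (f i))
    ⟨i₀, Finset.mem_range.2 hi₀⟩
  have hj0 : V.valuation (f j) ≠ 0 := by
    have h1 : V.valuation (f i₀) ≠ 0 := by simpa using hf
    exact ((zero_lt_iff.2 h1).trans_le (hmax i₀ (Finset.mem_range.2 hi₀))).ne'
  by_cases hex : ∃ i ∈ Finset.range n, i ≠ j ∧ V.valuation (f i) = V.valuation (f j)
  · obtain ⟨i, -, hij, hv⟩ := hex
    have hfj : f j ≠ 0 := by simpa using hj0
    have hfi : f i ≠ 0 := by rw [← hv] at hj0; simpa using hj0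
    rcases hij.lt_or_gt with h | h
    · exact ⟨i, j, h, hfi, hfj, hv⟩
    · exact ⟨j, i, h, hfj, hfi, hv.symm⟩
  · push Not at hex
    have := V.valuation.map_sum_eq_of_lt hj (fun i hi => by
      rw [Finset.mem_sdiff, Finset.mem_singleton] at hi
      exact lt_of_le_of_ne (hmax i hi.1) (hex i hi.1 hi.2))
    rw [hsum, map_zero] at this
    exact absurd this.symm hj0

/-- Two terms of an algebraic equation for `ω` have equal valuation, so some power of `ω` has the
valuation of a power of `t`. Since `ℚ` is divisible and roots are unique in an ordered group, `ω`
itself has such a valuation. -/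
lemma Dominates.exists_valuation_eq_tPow (hV : Dominates V) {ω : Ω} (hω : ω ≠ 0)
    (halg : IsAlgebraic (HahnSeries ℚ ℂ) ω) :
    ∃ q : ℚ, V.valuation ω = V.valuation (tPow Ω q) := by
  obtain ⟨p, hp, hpω⟩ := halg
  rw [Polynomial.aeval_eq_sum_range] at hpω
  simp only [Algebra.smul_def] at hpω
  obtain ⟨i, j, hij, hi, hj, hv⟩ := exists_ne_valuation_eq_of_sum_eq_zero (V := V) _ p.natDegree
    (Nat.lt_succ_self _) (by simpa [hω] using hp) hpω
  have hpi : p.coeff i ≠ 0 := fun h => hi (by simp [h])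
  have hpj : p.coeff j ≠ 0 := fun h => hj (by simp [h])
  rw [map_mul, map_mul, hV.eq_tPow_order hpi, hV.eq_tPow_order hpj] at hv
  obtain ⟨k, rfl⟩ := Nat.exists_eq_add_of_lt hij
  set oi := (p.coeff i).order
  set oj := (p.coeff (i + k + 1)).order
  refine ⟨(oi - oj) / (k + 1 : ℕ), ?_⟩
  have hω' : V.valuation ω ≠ 0 := by simpa using hω
  have hT : V.valuation (tPow Ω oj) ≠ 0 := by simp
  have key : V.valuation ω ^ (k + 1) = V.valuation (tPow Ω ((oi - oj) / (k + 1 : ℕ))) ^ (k + 1) := by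
    rw [← map_pow, ← map_pow, ← tPow_mul_natCast, div_mul_cancel₀ _ (by positivity)]
    have h1 : tPow Ω oi = tPow Ω (oi - oj) * tPow Ω oj := by rw [← tPow_add, sub_add_cancel]
    rw [h1, add_assoc, _root_.pow_add, map_mul, map_mul, map_pow, map_pow] at hv
    rw [map_pow]
    have hωi : V.valuation ω ^ i ≠ 0 := pow_ne_zero _ hω'
    apply mul_left_cancel₀ (mul_ne_zero hT hωi)
    rw [mul_assoc, ← hv]
    ac_rfl
  exact (pow_left_inj₀ zero_le zero_le (Nat.succ_ne_zero k)).1 key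

/-- The residue of `u` is algebraic over the residue field `ℂ`, hence lies in `ℂ`. -/
lemma Dominates.exists_residue (hV : Dominates V) {u : Ω} (hu : V.valuation u = 1)
    (halg : IsAlgebraic (HahnSeries ℚ ℂ) u) :
    ∃ c : ℂ, V.valuation (u - algebraMap _ Ω (HahnSeries.C c : HahnSeries ℚ ℂ)) < 1 := by
  obtain ⟨p, hp, hpu⟩ := halg
  obtain ⟨j, hj, hmin⟩ := Finset.exists_min_image p.support (fun i => (p.coeff i).orderTop)
    (Polynomial.support_nonempty.2 hp)
  have hpj : p.coeff j ≠ 0 := Polynomial.mem_support_iff.1 hj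
  -- Division by a coefficient of least order makes all coefficients integral and one of them equal
  -- to `1`, so the reduction `g` below is non-zero.
  set r : Polynomial (HahnSeries ℚ ℂ) := Polynomial.C (p.coeff j)⁻¹ * p with hr
  have hrj : r.coeff j = 1 := by simp [hr, inv_mul_cancel₀ hpj]
  have hro : ∀ i, 0 ≤ (r.coeff i).orderTop := by
    intro i
    by_cases hi : p.coeff i = 0
    · simp [hr, hi]
    · have h1 := hmin i (Polynomial.mem_support_iff.2 hi)
      rw [← order_eq_orderTop_of_ne_zero hpj, ← order_eq_orderTop_of_ne_zero hi,
        WithTop.coe_le_coe] at h1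
      rw [hr, Polynomial.coeff_C_mul, zero_le_orderTop_iff, order_mul (inv_ne_zero hpj) hi,
        order_inv_eq hpj]
      linarith
  have hru : Polynomial.aeval u r = 0 := by simp [hr, hpu]
  let g : Polynomial ℂ := ∑ i ∈ Finset.range (r.natDegree + 1),
    Polynomial.monomial i ((r.coeff i).coeff 0)
  have hjr : j < r.natDegree + 1 := by
    refine Nat.lt_succ_of_le (Polynomial.le_natDegree_of_ne_zero ?_)
    rw [hrj]; exact one_ne_zero
  have hg0 : g ≠ 0 := by
    intro h
    have := congrArg (fun f => Polynomial.coeff f j) h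
    simp only [g, Polynomial.finsetSum_coeff, Polynomial.coeff_monomial] at this
    rw [Finset.sum_ite_eq' (Finset.range (r.natDegree + 1)) j,
      if_pos (Finset.mem_range.2 hjr), hrj] at this
    simp at this
  let φ : ℂ →+* Ω := (algebraMap (HahnSeries ℚ ℂ) Ω).comp HahnSeries.C
  have hgu : V.valuation (g.eval₂ φ u) < 1 := by
    have h1 : g.eval₂ φ u = ∑ i ∈ Finset.range (r.natDegree + 1),
        algebraMap _ Ω (HahnSeries.C ((r.coeff i).coeff 0) - r.coeff i) * u ^ i := by
      rw [Polynomial.aeval_eq_sum_range] at hru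
      simp only [g, Polynomial.eval₂_finsetSum, Polynomial.eval₂_monomial, map_sub, sub_mul,
        Finset.sum_sub_distrib, ← Algebra.smul_def, hru, sub_zero]
      simp [φ, Algebra.smul_def]
    rw [h1]
    refine V.valuation.map_sum_lt one_ne_zero fun i _ => ?_
    rw [map_mul, map_pow, hu, one_pow, mul_one]
    apply hV.lt_one
    have h2 : 0 ≤ (HahnSeries.C ((r.coeff i).coeff 0) - r.coeff i).orderTop := by
      rw [sub_eq_add_neg]
      refine orderTop_add_nonneg ?_ (by simpa using hro i)
      rw [HahnSeries.C_apply]; exact orderTop_single_le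
    refine lt_of_le_of_ne h2 fun h => ?_
    have := coeff_orderTop_ne (g := 0) h.symm
    simp at this
  -- If no root of `g` were close to `u`, every linear factor, and so `g(u)`, would have valuation
  -- at least `1`.
  have hsplit := (IsAlgClosed.splits g).eq_prod_roots
  by_contra! hcon
  have h3 : g.eval₂ φ u = φ g.leadingCoeff * (g.roots.map fun c => u - φ c).prod := by
    conv_lhs => rw [hsplit]
    rw [Polynomial.eval₂_mul, Polynomial.eval₂_C, Polynomial.eval₂_multiset_prod, Multiset.map_map]
    simp
  rw [h3, map_mul] at hgu
  have h4 : V.valuation (φ g.leadingCoeff) = 1 := by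
    apply hV.eq_one
    · simpa using hg0
    · rw [order_C]
  rw [h4, one_mul, map_multiset_prod, Multiset.map_map] at hgu
  refine hgu.not_ge (Multiset.one_le_prod_of_one_le ?_)
  intro x hx
  obtain ⟨c, -, rfl⟩ := Multiset.mem_map.1 hx
  exact hcon c

lemma Dominates.exists_approx (hV : Dominates V) {ω : Ω} (hω : ω ≠ 0)
    (halg : IsAlgebraic (HahnSeries ℚ ℂ) ω) :
    ∃ (q : ℚ) (c : ℂ), V.valuation ω = V.valuation (tPow Ω q) ∧
      V.valuation (ω - algebraMap _ Ω (single q c)) < V.valuation (tPow Ω q) := by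
  obtain ⟨q, hq⟩ := hV.exists_valuation_eq_tPow hω halg
  have hT : V.valuation (tPow Ω q) ≠ 0 := by simp
  have hu : V.valuation (ω * (tPow Ω q)⁻¹) = 1 := by
    rw [map_mul, map_inv₀, hq, mul_inv_cancel₀ hT]
  obtain ⟨c, hc⟩ := hV.exists_residue hu (halg.mul (isAlgebraic_algebraMap _).inv)
  refine ⟨q, c, hq, ?_⟩
  have h : ω - algebraMap _ Ω (single q c) =
      (ω * (tPow Ω q)⁻¹ - algebraMap _ Ω (HahnSeries.C c : HahnSeries ℚ ℂ)) * tPow Ω q := by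
    rw [sub_mul, inv_mul_cancel_right₀ (tPow_ne_zero q), tPow, ← map_mul, HahnSeries.C_apply, single_mul_single]
    simp
  rw [h, map_mul]
  exact mul_lt_of_lt_one_left (zero_lt_iff.2 hT) hc

/-- The approximants of `ω` agree as far as their precision reaches, so their coefficients glue to
one series `z` at least as good as each of them. If `z` were not `ω`, adding the leading term of `ω
- z` would give a better one. -/
theorem Dominates.mem_range (hV : Dominates V) {ω : Ω}
    (halg : IsAlgebraic (HahnSeries ℚ ℂ) ω) : ∃ z : HahnSeries ℚ ℂ, algebraMap _ Ω z = ω := by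
  classical
  let A : HahnSeries ℚ ℂ → ℚ → Prop := fun a q =>
    V.valuation (ω - algebraMap _ Ω a) < V.valuation (tPow Ω q)
  have hlt : ∀ p q : ℚ, p < q → V.valuation (tPow Ω q) < V.valuation (tPow Ω p) := fun p q h => by
    rw [hV.lt_tPow_iff, orderTop_single one_ne_zero]; exact_mod_cast h
  have hdown : ∀ a p q, p ≤ q → A a q → A a p := fun a p q hpq h => by
    rcases hpq.lt_or_eq with h1 | rfl
    · exact h.trans (hlt _ _ h1)
    · exact h
  have hagree : ∀ a b q, A a q → A b q → ∀ p ≤ q, a.coeff p = b.coeff p := by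
    intro a b q ha hb p hp
    have h1 : V.valuation (algebraMap _ Ω (a - b)) < V.valuation (tPow Ω q) := by
      have : algebraMap _ Ω (a - b) = (ω - algebraMap _ Ω b) - (ω - algebraMap _ Ω a) := by
        rw [map_sub]; ring
      rw [this]
      exact (V.valuation.map_sub _ _).trans_lt (max_lt hb ha)
    rw [hV.lt_tPow_iff] at h1
    have := coeff_eq_zero_of_lt_orderTop ((WithTop.coe_le_coe.2 hp).trans_lt h1)
    rwa [HahnSeries.coeff_sub, sub_eq_zero] at this
  let c : ℚ → ℂ := fun q => if h : ∃ a, A a q then h.choose.coeff q else 0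
  have hc : ∀ a q, A a q → ∀ p ≤ q, c p = a.coeff p := by
    intro a q ha p hp
    have hap := hdown a p q hp ha
    have hex : ∃ a, A a p := ⟨a, hap⟩
    simp only [c, dif_pos hex]
    exact hagree _ _ p hex.choose_spec hap p le_rfl
  have hpwo : (Function.support c).IsPWO := by
    intro f
    -- Otherwise the whole sequence stays at or below `f 0`, where `c` coincides with the
    -- coefficients of a single approximant, whose support is well ordered.
    by_cases h : ∃ n, 0 < n ∧ (f 0 : ℚ) ≤ f n
    · obtain ⟨n, hn, hle⟩ := h
      exact ⟨0, n, hn, hle⟩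
    · push Not at h
      have hex : ∃ a, A a (f 0) := by
        by_contra hcon
        exact (f 0).2 (dif_neg hcon)
      obtain ⟨a, ha⟩ := hex
      refine a.isPWO_support fun n => ⟨f n, ?_⟩
      have hle : (f n : ℚ) ≤ f 0 := by
        rcases n.eq_zero_or_pos with rfl | hn
        · exact le_rfl
        · exact (h n hn).le
      have := (f n).2
      rwa [Function.mem_support, hc a _ ha _ hle] at this
  let z : HahnSeries ℚ ℂ := ⟨c, hpwo⟩
  have hz : ∀ a q, A a q → A z q := by
    intro a q ha
    have h1 : V.valuation (algebraMap _ Ω (a - z)) < V.valuation (tPow Ω q) := by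
      rw [hV.lt_tPow_iff]
      by_contra hcon
      have hne : a - z ≠ 0 := fun h => hcon (by rw [h, orderTop_zero]; exact WithTop.coe_lt_top q)
      rw [← order_eq_orderTop_of_ne_zero hne, WithTop.coe_lt_coe, not_lt] at hcon
      have h2 := hc a q ha _ hcon
      have h3 : (a - z).coeff (a - z).order ≠ 0 := coeff_order_eq_zero.not.2 hne
      exact h3 (by rw [HahnSeries.coeff_sub, ← h2]; exact sub_self _)
    have : ω - algebraMap _ Ω z = (ω - algebraMap _ Ω a) + algebraMap _ Ω (a - z) := by
      rw [map_sub]; ring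
    simp only [A]
    rw [this]
    exact (V.valuation.map_add _ _).trans_lt (max_lt ha h1)
  refine ⟨z, ?_⟩
  by_contra hne
  obtain ⟨q, d, hq, hd⟩ := hV.exists_approx (sub_ne_zero.2 (Ne.symm hne))
    (halg.sub (isAlgebraic_algebraMap z))
  have h1 : A (z + single q d) q := by
    simp only [A]
    rwa [map_add, ← sub_sub]
  exact (hz _ _ h1).ne hq

end AlgClosed

instance isAlgClosed_hahnSeries : IsAlgClosed (HahnSeries ℚ ℂ) := by
  refine IsAlgClosed.of_exists_root _ fun p hm hp => ?_
  obtain ⟨ω, hω⟩ := IsAlgClosed.exists_aeval_eq_zero (AlgebraicClosure (HahnSeries ℚ ℂ)) p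
    (Polynomial.degree_pos_of_irreducible hp).ne'
  obtain ⟨V, h1, h2⟩ := exists_valuationSubring_dominating
    (Ω := AlgebraicClosure (HahnSeries ℚ ℂ))
  obtain ⟨z, rfl⟩ := Dominates.mem_range ⟨h1, h2⟩ ⟨p, hp.ne_zero, hω⟩
  refine ⟨z, ?_⟩
  rw [Polynomial.aeval_algebraMap_apply] at hω
  simpa using hω

/-! ## Bivariate polynomial relations and degrees of field extensions -/

section Bivariate

open Polynomial.Bivariate

/-- Polynomials in `X` and `Y` as polynomials in `Y` over the polynomials in `X`. -/
abbrev asPolyY (F : MvPolynomial (Fin 2) ℂ) : Polynomial (Polynomial ℂ) :=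
  (equivMvPolynomial ℂ).symm F

lemma natDegree_asPolyY (F : MvPolynomial (Fin 2) ℂ) : (asPolyY F).natDegree = F.degreeOf 1 := by
  let e : MvPolynomial (Fin 2) ℂ →ₐ[ℂ] Polynomial (MvPolynomial (Fin 1) ℂ) :=
    (finSuccEquiv ℂ 1).toAlgHom.comp (rename (Equiv.swap 0 1))
  let c : Polynomial ℂ →ₐ[ℂ] MvPolynomial (Fin 1) ℂ := Polynomial.aeval (X 0)
  have hc : Function.Injective c := by
    have := (MvPolynomial.algebraicIndependent_X (Fin 1) ℂ).transcendental 0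
    exact transcendental_iff_injective.1 this
  have h : e = (Polynomial.mapAlgHom c).comp ((equivMvPolynomial ℂ).symm : _ →ₐ[ℂ] _) := by
    apply MvPolynomial.algHom_ext
    intro i
    fin_cases i
    · have h1 : (1 : Fin 2) = Fin.succ 0 := rfl
      simp only [e, c, Fin.zero_eta, AlgHom.comp_apply, rename_X, Equiv.swap_apply_left]
      have h2 := finSuccEquiv_X_succ (R := ℂ) (n := 1) (j := 0)
      rw [← h1] at h2
      simp [h2]
    · simp [e, c, finSuccEquiv_X_zero]
  have h2 := congrArg (fun f => (f F).natDegree) h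
  simp only [e, AlgHom.comp_apply] at h2
  have h3 := natDegree_finSuccEquiv (rename (Equiv.swap (0 : Fin 2) 1) F)
  have h4 := degreeOf_rename_of_injective (p := F) (Equiv.swap (0 : Fin 2) 1).injective 1
  rw [Equiv.swap_apply_right] at h4
  rw [← h4, ← h3]
  refine Eq.trans ?_ h2.symm
  exact (Polynomial.natDegree_map_eq_of_injective hc _).symm

lemma aeval_eq_eval₂_asPolyY {A : Type*} [CommRing A] [Algebra ℂ A] (a b : A)
    (F : MvPolynomial (Fin 2) ℂ) :
    aeval ![a, b] F = (asPolyY F).eval₂ (Polynomial.aeval (R := ℂ) a).toRingHom b := by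
  induction F using MvPolynomial.induction_on with
  | C c => simp [asPolyY, Polynomial.aeval_def]
  | add p q hp hq => simp_all [asPolyY, Polynomial.eval₂_add]
  | mul_X p i hp =>
    rw [map_mul, hp]
    fin_cases i <;> simp [asPolyY, Polynomial.eval₂_mul]

lemma coeff_zero_asPolyY (F : MvPolynomial (Fin 2) ℂ) :
    (asPolyY F).coeff 0 = aeval ![Polynomial.X, 0] F := by
  rw [aeval_eq_eval₂_asPolyY]
  simp only [AlgHom.toRingHom_eq_coe, Polynomial.eval₂_at_zero, RingHom.coe_coe]
  exact (Polynomial.aeval_X_left_apply _).symm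

lemma natDegree_aeval_X_C_le (F : MvPolynomial (Fin 2) ℂ) (c : ℂ) :
    (aeval ![Polynomial.X, Polynomial.C c] F).natDegree ≤ F.degreeOf 0 := by
  rw [aeval_def, eval₂_eq]
  refine Polynomial.natDegree_sum_le_of_forall_le _ _ fun m hm => ?_
  have h : ∏ i ∈ m.support, (![Polynomial.X, Polynomial.C c] : Fin 2 → Polynomial ℂ) i ^ m i =
      Polynomial.X ^ m 0 * Polynomial.C (c ^ m 1) := by
    rw [Finset.prod_subset (Finset.subset_univ _)]
    · simp [Fin.prod_univ_two]
    · intro i _ hi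
      rw [Finsupp.notMem_support_iff.1 hi, pow_zero]
  rw [h]
  refine (Polynomial.natDegree_C_mul_le _ _).trans ((Polynomial.natDegree_mul_C_le _ _).trans ?_)
  rw [Polynomial.natDegree_X_pow]
  exact monomial_le_degreeOf 0 hm

lemma natDegree_coeff_zero_asPolyY_le (F : MvPolynomial (Fin 2) ℂ) :
    ((asPolyY F).coeff 0).natDegree ≤ F.degreeOf 0 := by
  rw [coeff_zero_asPolyY, ← Polynomial.C_0]
  exact natDegree_aeval_X_C_le F 0

lemma asPolyY_pderiv (F : MvPolynomial (Fin 2) ℂ) :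
    asPolyY (pderiv 1 F) = Polynomial.derivative (asPolyY F) := by
  have h := pderiv_one_equivMvPolynomial (asPolyY F)
  rw [asPolyY, AlgEquiv.apply_symm_apply] at h
  rw [asPolyY, h, AlgEquiv.symm_apply_apply]

lemma irreducible_asPolyY {F : MvPolynomial (Fin 2) ℂ} (hF : Irreducible F) :
    Irreducible (asPolyY F) :=
  (MulEquiv.irreducible_iff (equivMvPolynomial ℂ).symm).2 hF

/-- Exchange of the two variables. -/
abbrev swapVars (F : MvPolynomial (Fin 2) ℂ) : MvPolynomial (Fin 2) ℂ :=
  rename (Equiv.swap (0 : Fin 2) 1) F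

lemma irreducible_swapVars {F : MvPolynomial (Fin 2) ℂ} (hF : Irreducible F) :
    Irreducible (swapVars F) :=
  (MulEquiv.irreducible_iff (renameEquiv ℂ (Equiv.swap (0 : Fin 2) 1))).2 hF

lemma aeval_swapVars {A : Type*} [CommRing A] [Algebra ℂ A] (a b : A)
    (F : MvPolynomial (Fin 2) ℂ) : aeval ![b, a] (swapVars F) = aeval ![a, b] F := by
  rw [swapVars, aeval_rename]
  congr 2
  ext i
  fin_cases i <;> simp

lemma degreeOf_one_swapVars (F : MvPolynomial (Fin 2) ℂ) :
    (swapVars F).degreeOf 1 = F.degreeOf 0 := by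
  have h4 := degreeOf_rename_of_injective (p := F) (Equiv.swap (0 : Fin 2) 1).injective 0
  rwa [Equiv.swap_apply_left] at h4

lemma map_aeval_pair {A B : Type*} [CommRing A] [Algebra ℂ A] [CommRing B] [Algebra ℂ B]
    (f : A →ₐ[ℂ] B) (a b : A) (F : MvPolynomial (Fin 2) ℂ) :
    f (aeval ![a, b] F) = aeval ![f a, f b] F := by
  have h : f.comp (aeval ![a, b]) = aeval ![f a, f b] := by
    apply MvPolynomial.algHom_ext
    intro i
    fin_cases i <;> simp
  exact congrArg (fun g => g F) h

end Bivariate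

/-! ### Gauss's lemma and degrees of extensions of `ℂ(a)`. -/

section FieldDegrees

open IntermediateField

variable {L : Type*} [Field L] [Algebra ℂ L]

lemma isAlgebraic_iff_mem_range {a : L} : IsAlgebraic ℂ a ↔ ∃ c : ℂ, algebraMap ℂ L c = a := by
  refine ⟨fun h => ?_, fun ⟨c, hc⟩ => hc ▸ isAlgebraic_algebraMap c⟩
  have := IsAlgClosed.splits (minpoly ℂ a)
  have h1 : (minpoly ℂ a).degree = 1 :=
    IsAlgClosed.degree_eq_one_of_irreducible ℂ (minpoly.irreducible h.isIntegral)
  obtain ⟨c, hc⟩ := minpoly.mem_range_of_degree_eq_one ℂ a h1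
  exact ⟨c, hc⟩

variable {a b : L}

lemma degreeOf_one_ne_zero {F : MvPolynomial (Fin 2) ℂ} (ha : Transcendental ℂ a)
    (hF : F ≠ 0) (h : aeval ![a, b] F = 0) : F.degreeOf 1 ≠ 0 := by
  intro h0
  rw [← natDegree_asPolyY, Polynomial.natDegree_eq_zero] at h0
  obtain ⟨p, hp⟩ := h0
  rw [aeval_eq_eval₂_asPolyY, ← hp, Polynomial.eval₂_C] at h
  have hp0 : p = 0 := by
    by_contra hne
    exact ha ⟨p, hne, h⟩
  rw [hp0, map_zero] at hp
  exact hF (by simpa using hp.symm)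

lemma isFractionRing_adjoin_simple (ha : Transcendental ℂ a) :
    letI : Algebra (Polynomial ℂ) ℂ⟮a⟯ :=
      (Polynomial.aeval (R := ℂ) (AdjoinSimple.gen ℂ a)).toRingHom.toAlgebra
    IsFractionRing (Polynomial ℂ) ℂ⟮a⟯ := by
  let _ : Algebra (Polynomial ℂ) ℂ⟮a⟯ :=
    (Polynomial.aeval (R := ℂ) (AdjoinSimple.gen ℂ a)).toRingHom.toAlgebra
  exact IsLocalization.isLocalization_of_algEquiv (nonZeroDivisors (Polynomial ℂ))
    (S := RatFunc ℂ) (AlgEquiv.ofRingEquiv (f := (RatFunc.algEquivOfTranscendental a ha).toRingEquiv)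
      (fun p => RatFunc.algEquivOfTranscendental_algebraMap a ha p))

/-- Coefficients in `ℂ[X]` regarded as elements of `ℂ(a)`. -/
abbrev coeffHom (a : L) : Polynomial ℂ →+* ℂ⟮a⟯ :=
  (Polynomial.aeval (R := ℂ) (AdjoinSimple.gen ℂ a)).toRingHom

lemma algebraMap_coeffHom (a : L) (p : Polynomial ℂ) :
    algebraMap ℂ⟮a⟯ L (coeffHom a p) = Polynomial.aeval a p := by
  change algebraMap ℂ⟮a⟯ L (Polynomial.aeval _ p) = _
  rw [← Polynomial.aeval_algebraMap_apply, AdjoinSimple.algebraMap_gen]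

lemma coeffHom_injective (ha : Transcendental ℂ a) : Function.Injective (coeffHom a) := by
  intro p q h
  have := congrArg (algebraMap ℂ⟮a⟯ L) h
  rw [algebraMap_coeffHom, algebraMap_coeffHom] at this
  exact transcendental_iff_injective.1 ha this

lemma aeval_map_coeffHom (q : MvPolynomial (Fin 2) ℂ) :
    Polynomial.aeval b ((asPolyY q).map (coeffHom a)) = aeval ![a, b] q := by
  rw [aeval_eq_eval₂_asPolyY, Polynomial.aeval_def, Polynomial.eval₂_map]
  congr 1
  ext p
  · simp
  · simp

/-- Gauss's lemma: as `a` is transcendental, `F` has positive degree in the second variable, so it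
is primitive and stays irreducible over `ℂ(a)`. -/
lemma minpoly_adjoin_simple {F : MvPolynomial (Fin 2) ℂ} (ha : Transcendental ℂ a)
    (hF : Irreducible F) (h : aeval ![a, b] F = 0) :
    minpoly ℂ⟮a⟯ b = (asPolyY F).map (coeffHom a) *
      Polynomial.C (coeffHom a (asPolyY F).leadingCoeff)⁻¹ := by
  let _ : Algebra (Polynomial ℂ) ℂ⟮a⟯ := (coeffHom a).toAlgebra
  have : IsFractionRing (Polynomial ℂ) ℂ⟮a⟯ := isFractionRing_adjoin_simple ha
  have hprim : (asPolyY F).IsPrimitive := (irreducible_asPolyY hF).isPrimitive (by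
    rw [natDegree_asPolyY]; exact degreeOf_one_ne_zero ha hF.ne_zero h)
  have hirr : Irreducible ((asPolyY F).map (coeffHom a)) :=
    (hprim.irreducible_iff_irreducible_map_fraction_map (K := ℂ⟮a⟯)).1 (irreducible_asPolyY hF)
  rw [← minpoly.eq_of_irreducible hirr (by rw [aeval_map_coeffHom, h]),
    Polynomial.leadingCoeff_map_of_injective (coeffHom_injective ha)]

/-- Divisibility holds over `ℂ(a)` by minimality and descends to `ℂ[X, Y]` because `F` is primitive.
-/
lemma dvd_of_aeval_eq_zero {F Q : MvPolynomial (Fin 2) ℂ} (ha : Transcendental ℂ a)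
    (hF : Irreducible F) (h : aeval ![a, b] F = 0) (hQ : aeval ![a, b] Q = 0) : F ∣ Q := by
  let _ : Algebra (Polynomial ℂ) ℂ⟮a⟯ := (coeffHom a).toAlgebra
  have : IsFractionRing (Polynomial ℂ) ℂ⟮a⟯ := isFractionRing_adjoin_simple ha
  have hprim : (asPolyY F).IsPrimitive := (irreducible_asPolyY hF).isPrimitive (by
    rw [natDegree_asPolyY]; exact degreeOf_one_ne_zero ha hF.ne_zero h)
  have h1 : minpoly ℂ⟮a⟯ b ∣ (asPolyY Q).map (coeffHom a) :=
    minpoly.dvd _ _ (by rw [aeval_map_coeffHom, hQ])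
  have h2 : (asPolyY F).map (coeffHom a) ∣ (asPolyY Q).map (coeffHom a) :=
    (Dvd.intro _ (minpoly_adjoin_simple ha hF h).symm).trans h1
  have h3 : asPolyY F ∣ asPolyY Q :=
    (hprim.dvd_iff_fraction_map_dvd_fraction_map (K := ℂ⟮a⟯)).2 h2
  exact (map_dvd_iff (Polynomial.Bivariate.equivMvPolynomial ℂ).symm).1 h3

lemma isIntegral_adjoin_simple {F : MvPolynomial (Fin 2) ℂ} (ha : Transcendental ℂ a)
    (hF : F ≠ 0) (h : aeval ![a, b] F = 0) : IsIntegral ℂ⟮a⟯ b := by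
  refine IsAlgebraic.isIntegral ⟨(asPolyY F).map (coeffHom a), ?_, by rw [aeval_map_coeffHom, h]⟩
  rw [Ne, Polynomial.map_eq_zero_iff (coeffHom_injective ha)]
  simpa using hF

lemma natDegree_minpoly_adjoin_simple {F : MvPolynomial (Fin 2) ℂ} (ha : Transcendental ℂ a)
    (hF : Irreducible F) (h : aeval ![a, b] F = 0) :
    (minpoly ℂ⟮a⟯ b).natDegree = F.degreeOf 1 := by
  rw [minpoly_adjoin_simple ha hF h, Polynomial.natDegree_mul_C,
    Polynomial.natDegree_map_eq_of_injective (coeffHom_injective ha), natDegree_asPolyY]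
  rw [Ne, inv_eq_zero, map_eq_zero_iff _ (coeffHom_injective ha), Polynomial.leadingCoeff_eq_zero]
  simpa using hF.ne_zero

lemma finrank_adjoin_simple {F : MvPolynomial (Fin 2) ℂ} (ha : Transcendental ℂ a)
    (hF : Irreducible F) (h : aeval ![a, b] F = 0) :
    Module.finrank ℂ⟮a⟯ ℂ⟮a⟯⟮b⟯ = F.degreeOf 1 := by
  rw [adjoin.finrank (isIntegral_adjoin_simple ha hF.ne_zero h),
    natDegree_minpoly_adjoin_simple ha hF h]

lemma adjoin_simple_eq_top (h : ℂ⟮a, b⟯ = ⊤) : ℂ⟮a⟯⟮b⟯ = ⊤ := by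
  rw [← adjoin_simple_adjoin_simple] at h
  exact restrictScalars_eq_top_iff.1 h

lemma finrank_eq_degreeOf_one {F : MvPolynomial (Fin 2) ℂ} (ha : Transcendental ℂ a)
    (hF : Irreducible F) (h : aeval ![a, b] F = 0) (htop : ℂ⟮a, b⟯ = ⊤) :
    Module.finrank ℂ⟮a⟯ L = F.degreeOf 1 := by
  rw [← finrank_adjoin_simple ha hF h, adjoin_simple_eq_top htop, finrank_top']

lemma finrank_eq_degreeOf_zero {F : MvPolynomial (Fin 2) ℂ} (hb : Transcendental ℂ b)
    (hF : Irreducible F) (h : aeval ![a, b] F = 0) (htop : ℂ⟮a, b⟯ = ⊤) :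
    Module.finrank ℂ⟮b⟯ L = F.degreeOf 0 := by
  rw [← degreeOf_one_swapVars]
  refine finrank_eq_degreeOf_one hb (irreducible_swapVars hF) (b := a) ?_ ?_
  · rw [aeval_swapVars, h]
  · rw [Set.pair_comm, htop]

lemma exists_irreducible_dvd {Q : MvPolynomial (Fin 2) ℂ} (hQ0 : Q ≠ 0)
    (hQ : aeval ![a, b] Q = 0) : ∃ F, Irreducible F ∧ F ∣ Q ∧ aeval ![a, b] F = 0 := by
  induction Q using WfDvdMonoid.induction_on_irreducible with
  | zero => exact absurd rfl hQ0
  | unit u hu => exact absurd hQ (hu.map (aeval ![a, b])).ne_zero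
  | mul q i hq hi ih =>
    rw [map_mul, mul_eq_zero] at hQ
    rcases hQ with h | h
    · exact ⟨i, hi, dvd_mul_right i q, h⟩
    · obtain ⟨F, hF, hd, h0⟩ := ih hq h
      exact ⟨F, hF, hd.mul_left i, h0⟩

lemma exists_irreducible_of_isAlgebraic (ha : Transcendental ℂ a) (hb : IsAlgebraic ℂ⟮a⟯ b) :
    ∃ F : MvPolynomial (Fin 2) ℂ, Irreducible F ∧ aeval ![a, b] F = 0 := by
  let _ : Algebra (Polynomial ℂ) ℂ⟮a⟯ := (coeffHom a).toAlgebra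
  have : IsFractionRing (Polynomial ℂ) ℂ⟮a⟯ := isFractionRing_adjoin_simple ha
  let _ : Algebra (Polynomial ℂ) L := ((algebraMap ℂ⟮a⟯ L).comp (coeffHom a)).toAlgebra
  have : IsScalarTower (Polynomial ℂ) ℂ⟮a⟯ L := IsScalarTower.of_algebraMap_eq' rfl
  obtain ⟨p, hp, hpb⟩ := (IsFractionRing.isAlgebraic_iff (Polynomial ℂ) ℂ⟮a⟯ L).2 hb
  obtain ⟨Q, rfl⟩ := (Polynomial.Bivariate.equivMvPolynomial ℂ).symm.surjective p
  have hQ : aeval ![a, b] Q = 0 := by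
    rw [aeval_eq_eval₂_asPolyY, ← hpb, Polynomial.aeval_def]
    congr 1
    ext p <;> simp [RingHom.algebraMap_toAlgebra]
  have hQ0 : Q ≠ 0 := by rintro rfl; simp at hp
  obtain ⟨F, hF, -, h⟩ := exists_irreducible_dvd hQ0 hQ
  exact ⟨F, hF, h⟩

/-- The norm to `ℂ(x)` of an element `f`, as a quotient of polynomials with the degree of the
numerator bounded by the degree of the extension over `ℂ(f)`. -/
lemma exists_norm_eq {x f : L} (hx : Transcendental ℂ x) [FiniteDimensional ℂ⟮x⟯ L]
    (hf : Transcendental ℂ f) :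
    ∃ p q : Polynomial ℂ, q ≠ 0 ∧ p.natDegree ≤ Module.finrank ℂ⟮f⟯ L ∧
      Algebra.norm ℂ⟮x⟯ f * coeffHom x q = coeffHom x p := by
  obtain ⟨Q, hQ, hQ0⟩ := exists_irreducible_of_isAlgebraic hx (b := f)
    (Algebra.IsAlgebraic.isAlgebraic f)
  have hint : IsIntegral ℂ⟮x⟯ f := isIntegral_adjoin_simple hx hQ.ne_zero hQ0
  set r := Module.finrank ℂ⟮x⟯⟮f⟯ L with hr
  set d := (adjoin.powerBasis hint).dim
  have hlc : (asPolyY Q).leadingCoeff ≠ 0 := by simpa using hQ.ne_zero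
  refine ⟨((-1) ^ d * (asPolyY Q).coeff 0) ^ r, (asPolyY Q).leadingCoeff ^ r,
    pow_ne_zero _ hlc, ?_, ?_⟩
  -- Both towers pass through `ℂ(x, f)`: the degree of `L` over it is `r`, and `[ℂ(x, f) : ℂ(f)]` is
  -- the degree of `Q` in `x`. The norm of `f` is the `r`-th power of its norm from `ℂ(x, f)`, which
  -- is read off the constant coefficient of `Q`.
  · have h1 : Module.finrank ℂ⟮f⟯ L = Q.degreeOf 0 * r := by
      rw [← Module.finrank_mul_finrank ℂ⟮f⟯ ℂ⟮f⟯⟮x⟯ L, ← degreeOf_one_swapVars,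
        finrank_adjoin_simple hf (irreducible_swapVars hQ) (by rw [aeval_swapVars, hQ0])]
      congr 1
      change Module.finrank (restrictScalars ℂ ℂ⟮f⟯⟮x⟯) L =
        Module.finrank (restrictScalars ℂ ℂ⟮x⟯⟮f⟯) L
      rw [adjoin_simple_comm]
    rw [h1, mul_comm (Q.degreeOf 0)]
    refine Polynomial.natDegree_pow_le.trans (Nat.mul_le_mul_left r ?_)
    have h2 : ((-1 : Polynomial ℂ) ^ d) = Polynomial.C ((-1) ^ d) := by simp
    rw [h2]
    exact (Polynomial.natDegree_C_mul_le _ _).trans (natDegree_coeff_zero_asPolyY_le Q)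
  · have h3 : Algebra.norm ℂ⟮x⟯ (AdjoinSimple.gen ℂ⟮x⟯ f) =
        (-1) ^ d * (coeffHom x ((asPolyY Q).coeff 0) * (coeffHom x (asPolyY Q).leadingCoeff)⁻¹) := by
      have h4 := Algebra.PowerBasis.norm_gen_eq_coeff_zero_minpoly (adjoin.powerBasis hint)
      rw [adjoin.powerBasis_gen, minpoly_gen, minpoly_adjoin_simple hx hQ hQ0,
        Polynomial.coeff_mul_C, Polynomial.coeff_map] at h4
      exact h4
    have h5 : coeffHom x (asPolyY Q).leadingCoeff ≠ 0 := by
      rwa [Ne, map_eq_zero_iff _ (coeffHom_injective hx)]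
    rw [Algebra.norm_eq_norm_adjoin, h3, map_pow, map_pow, ← mul_pow, map_mul, map_pow, map_neg,
      map_one]
    congr 1
    field_simp

end FieldDegrees

/-! ## Derivations on fields of algebraic functions -/

section Derivations

open IntermediateField

/-- The `ℂ`-linear derivations from an extension field of `ℂ` to itself. -/
abbrev SelfDerivation (L : Type*) [Field L] [Algebra ℂ L] : Type _ := Derivation ℂ L L

variable {L : Type*} [Field L] [Algebra ℂ L]

/-- A derivation from a function with the required properties. -/
def SelfDerivation.mk (f : L → L) (hadd : ∀ a b, f (a + b) = f a + f b)
    (hsmul : ∀ (c : ℂ) a, f (algebraMap ℂ L c * a) = algebraMap ℂ L c * f a)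
    (hmul : ∀ a b, f (a * b) = a * f b + b * f a) : SelfDerivation L :=
  Derivation.mk'
    { toFun := f
      map_add' := hadd
      map_smul' := fun c a => by simp only [Algebra.smul_def, hsmul, RingHom.id_apply] }
    hmul

lemma SelfDerivation.map_constant (D : SelfDerivation L) (c : ℂ) : D (algebraMap ℂ L c) = 0 :=
  D.map_algebraMap c

/-- The multiple of a derivation by an element of the field. -/
def SelfDerivation.mulLeft (D : SelfDerivation L) (c : L) : SelfDerivation L := c • D

lemma derivation_aeval_pair (D : Derivation ℂ L L) (a b : L) (F : MvPolynomial (Fin 2) ℂ) :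
    D (aeval ![a, b] F) = aeval ![a, b] (pderiv 0 F) * D a + aeval ![a, b] (pderiv 1 F) * D b := by
  induction F using MvPolynomial.induction_on with
  | C c => simp
  | add p q hp hq => simp only [map_add, hp, hq]; ring
  | mul_X p i hp =>
    simp only [map_mul, Derivation.leibniz, hp, smul_eq_mul, map_add, aeval_X, pderiv_X]
    fin_cases i <;> simp <;> ring

/-- Otherwise `P` would divide its own derivative, which is non-zero and of smaller degree. -/
lemma pderiv_one_aeval_ne_zero {a b : L} (ha : Transcendental ℂ a) {P : MvPolynomial (Fin 2) ℂ}
    (hP : Irreducible P) (h : aeval ![a, b] P = 0) : aeval ![a, b] (pderiv 1 P) ≠ 0 := by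
  intro h0
  have h1 := dvd_of_aeval_eq_zero ha hP h h0
  have h2 : asPolyY P ∣ Polynomial.derivative (asPolyY P) := by
    rw [← asPolyY_pderiv]; exact map_dvd (Polynomial.Bivariate.equivMvPolynomial ℂ).symm h1
  have h3 : (asPolyY P).natDegree ≠ 0 := by
    rw [natDegree_asPolyY]; exact degreeOf_one_ne_zero ha hP.ne_zero h
  have h4 : Polynomial.derivative (asPolyY P) ≠ 0 := fun h =>
    h3 (Polynomial.derivative_eq_zero.1 h)
  exact absurd (Polynomial.natDegree_le_of_dvd h2 h4) (not_le.2 (Polynomial.natDegree_derivative_lt h3))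

lemma derivation_mem_adjoin (D : Derivation ℂ L L) {S : Set L}
    (h : ∀ s ∈ S, D s ∈ adjoin ℂ S) {z : L} (hz : z ∈ adjoin ℂ S) : D z ∈ adjoin ℂ S := by
  induction hz using adjoin_induction with
  | mem s hs => exact h s hs
  | algebraMap c => rw [D.map_algebraMap]; exact zero_mem _
  | add a b ha hb iha ihb => rw [map_add]; exact add_mem iha ihb
  | inv a ha iha =>
    rw [D.leibniz_inv]
    exact mul_mem (neg_mem (pow_mem (inv_mem ha) 2)) iha
  | mul a b ha hb iha ihb =>
    rw [D.leibniz]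
    exact add_mem (mul_mem ha ihb) (mul_mem hb iha)

/-- The restriction of a derivation to an invariant intermediate field. -/
def restrictDer (D : Derivation ℂ L L) (E : IntermediateField ℂ L) (h : ∀ z ∈ E, D z ∈ E) :
    Derivation ℂ E E :=
  Derivation.mk' ((D : L →ₗ[ℂ] L).restrict (p := E.toSubalgebra.toSubmodule)
    (q := E.toSubalgebra.toSubmodule) h) fun a b => Subtype.ext (D.leibniz (a : L) (b : L))

@[simp] lemma coe_restrictDer (D : Derivation ℂ L L) (E : IntermediateField ℂ L)
    (h : ∀ z ∈ E, D z ∈ E) (z : E) : (restrictDer D E h z : L) = D z := rfl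

/-- Chain rule for polynomials with non-constant coefficients; `e` is obtained by differentiating
the coefficients. -/
lemma exists_derivation_aeval (D : Derivation ℂ L L) {E : IntermediateField ℂ L}
    (D₀ : Derivation ℂ E E) (hD : ∀ z : E, (D₀ z : L) = D z) (x : L) (p : Polynomial E) :
    ∃ e : Polynomial E, (∀ i, e.coeff i = D₀ (p.coeff i)) ∧
      D (Polynomial.aeval x p) =
        Polynomial.aeval x e + Polynomial.aeval x (Polynomial.derivative p) * D x := by
  induction p using Polynomial.induction_on' with
  | add p q hp hq =>
    obtain ⟨e, he, hp⟩ := hp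
    obtain ⟨f, hf, hq⟩ := hq
    refine ⟨e + f, fun i => by simp [he, hf], ?_⟩
    simp only [map_add, hp, hq]
    ring
  | monomial n a =>
    refine ⟨Polynomial.monomial n (D₀ a), fun i => ?_, ?_⟩
    · rw [Polynomial.coeff_monomial, Polynomial.coeff_monomial]
      split_ifs <;> simp
    · rw [Polynomial.aeval_monomial, Polynomial.aeval_monomial, Polynomial.derivative_monomial,
        Polynomial.aeval_monomial, D.leibniz, D.leibniz_pow]
      have h1 : algebraMap E L (D₀ a) = D (algebraMap E L a) := hD a
      rw [h1, map_mul, map_natCast]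
      simp only [smul_eq_mul, nsmul_eq_mul]
      ring

/-- If `x' = 1`, `x` is algebraic over an invariant subfield and all constants are complex
numbers, then `x` lies in the subfield. -/
lemma mem_of_isIntegral_of_derivation_eq_one (D : Derivation ℂ L L)
    (hconst : ∀ z, D z = 0 → ∃ c : ℂ, algebraMap ℂ L c = z) {E : IntermediateField ℂ L}
    (hE : ∀ z ∈ E, D z ∈ E) {x : L} (hx : D x = 1) (hint : IsIntegral E x) : x ∈ E := by
  set p := minpoly E x with hp
  obtain ⟨e, he, hDe⟩ := exists_derivation_aeval D (restrictDer D E hE) (fun _ => rfl) x p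
  rw [hp, minpoly.aeval, map_zero, ← hp, hx, mul_one, ← map_add] at hDe
  have hmonic : p.Monic := minpoly.monic hint
  have hpos : 0 < p.natDegree := minpoly.natDegree_pos hint
  obtain ⟨n, hn⟩ := Nat.exists_eq_succ_of_ne_zero hpos.ne'
  have hlead : p.coeff (n + 1) = 1 := by rw [← Nat.succ_eq_add_one, ← hn]; exact hmonic
  -- Differentiating `p(x) = 0` gives a relation of smaller degree, since `p` is monic; by
  -- minimality it is trivial. Its coefficient of degree `n` says that `(n + 1) x + p.coeff n` is a
  -- constant.
  have hzero : e + Polynomial.derivative p = 0 := by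
    by_contra hne
    have h1 := minpoly.degree_le_of_ne_zero E x hne hDe.symm
    rw [← hp, Polynomial.degree_eq_natDegree hmonic.ne_zero] at h1
    have h2 : (e + Polynomial.derivative p).degree < p.natDegree := by
      rw [Polynomial.degree_lt_iff_coeff_zero]
      intro i hi
      rw [Polynomial.coeff_add, he, Polynomial.coeff_derivative,
        Polynomial.coeff_eq_zero_of_natDegree_lt (Nat.lt_succ_of_le hi)]
      rcases hi.lt_or_eq with h | h
      · rw [Polynomial.coeff_eq_zero_of_natDegree_lt h]; simp
      · have : p.coeff i = 1 := by rw [← h]; exact hmonic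
        rw [this, Derivation.map_one_eq_zero]; simp
    exact (h1.trans_lt h2).false
  have hcoeff := congrArg (fun q => (q.coeff n : L)) hzero
  simp only [Polynomial.coeff_add, he, Polynomial.coeff_derivative, hlead, one_mul,
    Polynomial.coeff_zero] at hcoeff
  have hcoeff' : D (p.coeff n : L) + (n + 1) = 0 := by
    simpa using hcoeff
  have hn0 : ((n : L) + 1) ≠ 0 := by
    have : CharZero L := charZero_of_injective_algebraMap (algebraMap ℂ L).injective
    exact_mod_cast Nat.succ_ne_zero n
  obtain ⟨c, hc⟩ := hconst (((n : L) + 1) * x + p.coeff n) (by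
    rw [map_add, D.leibniz, hx, map_add, D.map_natCast, D.map_one_eq_zero]
    simp only [smul_eq_mul, mul_one, add_zero, mul_zero]
    rw [add_comm, hcoeff'])
  have hxe : x = (algebraMap ℂ L c - p.coeff n) * ((n : L) + 1)⁻¹ := by
    rw [hc]; field_simp; ring
  rw [hxe]
  exact mul_mem (sub_mem (E.algebraMap_mem c) (p.coeff n).2)
    (inv_mem (add_mem (_root_.natCast_mem E n) (one_mem E)))

lemma transcendental_of_derivation_ne_zero (D : Derivation ℂ L L) {z : L} (hz : D z ≠ 0) :
    Transcendental ℂ z := by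
  intro h
  obtain ⟨c, rfl⟩ := isAlgebraic_iff_mem_range.1 h
  exact hz (D.map_algebraMap c)

variable (D : Derivation ℂ L L) {x y : L} {P G : MvPolynomial (Fin 2) ℂ}

/-- Differentiating `P(y, y') = 0` expresses `y''` rationally in `y` and `y'`, the separant being
non-zero there. -/
lemma derivation_mem_adjoin_pair (hy : D y ≠ 0) (hP : Irreducible P)
    (hPy : aeval ![y, D y] P = 0) {z : L} (hz : z ∈ ℂ⟮y, D y⟯) : D z ∈ ℂ⟮y, D y⟯ := by
  refine derivation_mem_adjoin D ?_ hz
  have h1 : y ∈ ℂ⟮y, D y⟯ := subset_adjoin _ _ (by simp)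
  have h2 : D y ∈ ℂ⟮y, D y⟯ := subset_adjoin _ _ (by simp)
  rintro s (rfl | rfl)
  · exact h2
  · have hne := pderiv_one_aeval_ne_zero (transcendental_of_derivation_ne_zero D hy) hP hPy
    have h3 := derivation_aeval_pair D y (D y) P
    rw [hPy, map_zero] at h3
    have h4 : D (D y) = -(aeval ![y, D y] (pderiv 0 P) * D y) * (aeval ![y, D y] (pderiv 1 P))⁻¹ := by
      rw [eq_mul_inv_iff_mul_eq₀ hne]
      linear_combination -h3
    have hmem : ∀ F : MvPolynomial (Fin 2) ℂ, aeval ![y, D y] F ∈ ℂ⟮y, D y⟯ := by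
      intro F
      have := map_aeval_pair (IntermediateField.val ℂ⟮y, D y⟯) ⟨y, h1⟩ ⟨D y, h2⟩ F
      rw [IntermediateField.coe_val] at this
      exact this ▸ Subtype.prop _
    rw [h4]
    exact mul_mem (neg_mem (mul_mem (hmem _) h2)) (inv_mem (hmem _))

/-- The independent variable is a rational function of a solution and its derivative. -/
lemma adjoin_derivation_eq_top (hconst : ∀ z, D z = 0 → ∃ c : ℂ, algebraMap ℂ L c = z)
    (hx : D x = 1) (hy : D y ≠ 0) (htop : ℂ⟮x, y⟯ = ⊤)
    (hG : Irreducible G) (hGy : aeval ![x, y] G = 0)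
    (hP : Irreducible P) (hPy : aeval ![y, D y] P = 0) : ℂ⟮y, D y⟯ = ⊤ := by
  have hyE : y ∈ ℂ⟮y, D y⟯ := subset_adjoin _ _ (by simp)
  have hle : ℂ⟮y⟯ ≤ ℂ⟮y, D y⟯ := adjoin_le_iff.2 (by rintro _ rfl; exact hyE)
  have hint : IsIntegral ℂ⟮y⟯ x := isIntegral_adjoin_simple
    (transcendental_of_derivation_ne_zero D hy) (irreducible_swapVars hG).ne_zero
    (by rw [aeval_swapVars, hGy])
  have hint' : IsIntegral ℂ⟮y, D y⟯ x := by
    obtain ⟨p, hm, hp⟩ := hint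
    refine ⟨p.map (inclusion hle), hm.map _, ?_⟩
    rw [Polynomial.eval₂_map]
    exact hp
  have hxE := mem_of_isIntegral_of_derivation_eq_one D hconst
    (fun z hz => derivation_mem_adjoin_pair D hy hP hPy hz) hx hint'
  rw [eq_top_iff, ← htop, adjoin_le_iff]
  rintro s (rfl | rfl)
  · exact hxE
  · exact hyE

end Derivations

/-! ## The derivation on Hahn series -/

section HahnDerivation

open HahnSeries

lemma algebraMap_hahnSeries_apply (c : ℂ) :
    algebraMap ℂ (HahnSeries ℚ ℂ) c = HahnSeries.C c :=
  (HahnSeries.algebraMap_apply' ℚ c).trans (by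
    exact HahnSeries.ofPowerSeries_C c)

lemma euler_mul (a b : HahnSeries ℚ ℂ) : euler (a * b) = a * euler b + b * euler a := by
  have h : ∀ y : HahnSeries ℚ ℂ, (euler y).support ⊆ y.support := fun y q hq =>
    right_ne_zero_of_mul hq
  -- The support of `euler y` lies in that of `y`, so all three products can be summed over the same
  -- pairs of exponents.
  ext q
  rw [mul_comm b, HahnSeries.coeff_add, coeff_mul_right' b.isPWO_support (h b),
    coeff_mul_left' a.isPWO_support (h a), ← Finset.sum_add_distrib]
  change (q : ℂ) * (a * b).coeff q = _
  rw [HahnSeries.coeff_mul, Finset.mul_sum]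
  refine Finset.sum_congr rfl fun ij hij => ?_
  have hq : ij.1 + ij.2 = q := (Finset.mem_antidiagonal.1 hij).2.2
  change _ = a.coeff ij.1 * ((ij.2 : ℂ) * b.coeff ij.2) + (ij.1 : ℂ) * a.coeff ij.1 * b.coeff ij.2
  rw [← hq]
  push_cast
  ring

/-- The operator `t d/dt` as a derivation. -/
def eulerDer : SelfDerivation (HahnSeries ℚ ℂ) :=
  SelfDerivation.mk euler
    (fun a b => by
      ext q
      exact mul_add (q : ℂ) (a.coeff q) (b.coeff q))
    (fun c a => by
      rw [algebraMap_hahnSeries_apply, euler_mul, HahnSeries.C_apply]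
      have h : euler (single 0 c) = 0 := by
        ext q
        change (q : ℂ) * _ = _
        rw [HahnSeries.coeff_single]
        split_ifs with h <;> simp [h]
      rw [h, mul_zero, add_zero])
    euler_mul

/-- The derivation `d/dx`. -/
def ddxDer : OnePoint ℂ → SelfDerivation (HahnSeries ℚ ℂ)
  | none => eulerDer.mulLeft (-single 1 1)
  | some _ => eulerDer.mulLeft (single (-1) 1)

lemma ddxDer_apply (x₀ : OnePoint ℂ) (y : HahnSeries ℚ ℂ) : ddxDer x₀ y = ddx x₀ y := by
  cases x₀ with
  | infty => exact neg_mul (single 1 1) (euler y)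
  | coe c => rfl

lemma coeff_euler (y : HahnSeries ℚ ℂ) (q : ℚ) : (euler y).coeff q = q * y.coeff q := rfl

lemma euler_single (q : ℚ) (c : ℂ) : euler (single q c) = single q (q * c) := by
  ext p
  rw [coeff_euler, HahnSeries.coeff_single, HahnSeries.coeff_single]
  split_ifs with h
  · rw [h]
  · simp

lemma ddxDer_xSeries (x₀ : OnePoint ℂ) : ddxDer x₀ (xSeries x₀) = 1 := by
  rw [ddxDer_apply]
  cases x₀ with
  | infty =>
    change -(single 1 1 * euler (single (-1) 1)) = (1 : HahnSeries ℚ ℂ)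
    rw [euler_single, single_mul_single]
    simp
  | coe c =>
    change single (-1) 1 * eulerDer (HahnSeries.C c + single 1 1) = (1 : HahnSeries ℚ ℂ)
    rw [map_add, ← algebraMap_hahnSeries_apply, eulerDer.map_constant, zero_add]
    change single (-1) 1 * euler (single 1 1) = (1 : HahnSeries ℚ ℂ)
    rw [euler_single, single_mul_single]
    simp

lemma exists_eq_C_of_ddxDer_eq_zero (x₀ : OnePoint ℂ) {z : HahnSeries ℚ ℂ}
    (hz : ddxDer x₀ z = 0) : ∃ c : ℂ, algebraMap ℂ _ c = z := by
  have h : euler z = 0 := by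
    rw [ddxDer_apply] at hz
    cases x₀ with
    | infty =>
      have hz' : -(single 1 1 * euler z) = (0 : HahnSeries ℚ ℂ) := hz
      simpa using hz'
    | coe c =>
      have hz' : single (-1) 1 * euler z = (0 : HahnSeries ℚ ℂ) := hz
      simpa using hz'
  refine ⟨z.coeff 0, ?_⟩
  rw [algebraMap_hahnSeries_apply]
  ext q
  rw [HahnSeries.C_apply, HahnSeries.coeff_single]
  split_ifs with h0
  · rw [h0]
  · have := congrArg (fun w => w.coeff q) h
    simp only [coeff_euler, HahnSeries.coeff_zero, mul_eq_zero, Rat.cast_eq_zero] at this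
    exact (this.resolve_left h0).symm

end HahnDerivation

/-! ## Orders of Hahn series in `1 / x` -/

section Orders

open HahnSeries

/-- The expansion of `x` at infinity. -/
abbrev xInf : HahnSeries ℚ ℂ := xSeries OnePoint.infty

lemma transcendental_xSeries (x₀ : OnePoint ℂ) : Transcendental ℂ (xSeries x₀) :=
  transcendental_of_derivation_ne_zero (ddxDer x₀) (by rw [ddxDer_xSeries]; exact one_ne_zero)

lemma order_aeval_xInf {p : Polynomial ℂ} (hp : p ≠ 0) :
    (Polynomial.aeval xInf p).order = -(p.natDegree : ℚ) := by
  have h : Polynomial.aeval xInf p =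
      ∑ i ∈ Finset.range (p.natDegree + 1), single (-(i : ℚ)) (p.coeff i) := by
    rw [Polynomial.aeval_eq_sum_range]
    refine Finset.sum_congr rfl fun i _ => ?_
    rw [Algebra.smul_def, algebraMap_hahnSeries_apply, HahnSeries.C_apply]
    change single 0 (p.coeff i) * (single (-1) 1) ^ i = _
    rw [single_pow, single_mul_single]
    simp
  have hcoeff : ∀ q : ℚ, (Polynomial.aeval xInf p).coeff q =
      ∑ i ∈ Finset.range (p.natDegree + 1), if q = -(i : ℚ) then p.coeff i else 0 := by
    intro q
    rw [h, HahnSeries.coeff_sum]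
    refine Finset.sum_congr rfl fun i _ => ?_
    rw [HahnSeries.coeff_single]
    split_ifs <;> rfl
  have hne : Polynomial.aeval xInf p ≠ 0 := fun h0 =>
    transcendental_xSeries OnePoint.infty ⟨p, hp, h0⟩
  refine le_antisymm (order_le_of_coeff_ne_zero ?_) ((le_order_iff_forall hne).2 fun q hq => ?_)
  · rw [hcoeff, Finset.sum_eq_single p.natDegree]
    · simpa using hp
    · intro i _ hi
      rw [if_neg]
      intro h
      exact hi (by exact_mod_cast (neg_injective h).symm)
    · simp
  · rw [hcoeff]
    refine Finset.sum_eq_zero fun i hi => if_neg fun h => ?_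
    rw [h, neg_lt_neg_iff, Nat.cast_lt] at hq
    exact absurd (Finset.mem_range.1 hi) (by omega)

/-- Subtracting a generic constant removes zeros and keeps poles, so that the order counts poles
only. -/
lemma order_sub_algebraMap_le {w : HahnSeries ℚ ℂ} {c : ℂ} (hc : c ≠ w.coeff 0) :
    w - algebraMap ℂ _ c ≠ 0 ∧ (w - algebraMap ℂ _ c).order ≤ 0 ∧
      (w - algebraMap ℂ _ c).order ≤ w.order := by
  have h0 : (w - algebraMap ℂ _ c).coeff 0 ≠ 0 := by
    rw [HahnSeries.coeff_sub, algebraMap_hahnSeries_apply, HahnSeries.C_apply,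
      HahnSeries.coeff_single, if_pos rfl, sub_ne_zero]
    exact hc.symm
  have h1 : (w - algebraMap ℂ _ c).order ≤ 0 := order_le_of_coeff_ne_zero h0
  refine ⟨ne_zero_of_coeff_ne_zero h0, h1, ?_⟩
  rcases le_or_gt 0 w.order with h | h
  · exact h1.trans h
  · refine order_le_of_coeff_ne_zero ?_
    have hw : w ≠ 0 := by rintro rfl; simp at h
    rw [HahnSeries.coeff_sub, algebraMap_hahnSeries_apply, HahnSeries.C_apply,
      HahnSeries.coeff_single, if_neg h.ne, sub_zero]
    exact coeff_order_eq_zero.not.2 hw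

/-- A pole of `x` is a pole of `w` or a zero of `w'`. -/
lemma order_add_order_le {w : HahnSeries ℚ ℂ} (hw : ddx OnePoint.infty w ≠ 0) {c₁ c₂ : ℂ}
    (h₁ : c₁ ≠ w.coeff 0) (h₂ : c₂ ≠ ((ddx OnePoint.infty w)⁻¹).coeff 0) :
    (w - algebraMap ℂ _ c₁).order + ((ddx OnePoint.infty w)⁻¹ - algebraMap ℂ _ c₂).order ≤ -1 := by
  have hd : ddx OnePoint.infty w = -(single 1 1 * euler w) := rfl
  have he : euler w ≠ 0 := by
    intro h; rw [hd, h, mul_zero, neg_zero] at hw; exact hw rfl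
  have hord : ((ddx OnePoint.infty w)⁻¹).order = -(1 + (euler w).order) := by
    rw [order_inv_eq hw, hd, order_neg, order_mul (by simp) he, order_single one_ne_zero]
  -- In `t = 1/x` the derivation is `-t` times `t d/dt`, and `t d/dt` does not lower the order;
  -- hence `d/dx` raises it by at least one.
  have hle : w.order ≤ (euler w).order := by
    rw [le_order_iff_forall he]
    intro q hq
    rw [coeff_euler, coeff_eq_zero_of_lt_order hq, mul_zero]
  obtain ⟨-, h3, h4⟩ := order_sub_algebraMap_le h₁
  obtain ⟨-, h5, h6⟩ := order_sub_algebraMap_le h₂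
  rw [hord] at h6
  linarith

lemma order_prod_eq {ι : Type*} (s : Finset ι) (f : ι → HahnSeries ℚ ℂ) (hf : ∀ i ∈ s, f i ≠ 0) :
    (∏ i ∈ s, f i).order = ∑ i ∈ s, (f i).order := by
  classical
  induction s using Finset.induction_on with
  | empty => simp
  | insert a s ha ih =>
    have hs : ∀ i ∈ s, f i ≠ 0 := fun i hi => hf i (Finset.mem_insert_of_mem hi)
    rw [Finset.prod_insert ha, Finset.sum_insert ha, order_mul (hf a (Finset.mem_insert_self a s))
      (Finset.prod_ne_zero_iff.2 hs), ih hs]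

end Orders

/-! ## The degree bounds -/

section DegreeBounds

open IntermediateField

lemma adjoin_simple_sub_algebraMap {L : Type*} [Field L] [Algebra ℂ L] (a : L) (c : ℂ) :
    ℂ⟮a - algebraMap ℂ L c⟯ = ℂ⟮a⟯ := by
  apply le_antisymm
  · rw [adjoin_simple_le_iff]
    exact sub_mem (mem_adjoin_simple_self ℂ a) (IntermediateField.algebraMap_mem _ c)
  · rw [adjoin_simple_le_iff]
    have := add_mem (mem_adjoin_simple_self ℂ (a - algebraMap ℂ L c))
      (IntermediateField.algebraMap_mem ℂ⟮a - algebraMap ℂ L c⟯ c)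
    rwa [sub_add_cancel] at this

lemma adjoin_simple_inv {L : Type*} [Field L] [Algebra ℂ L] (a : L) : ℂ⟮a⁻¹⟯ = ℂ⟮a⟯ := by
  apply le_antisymm
  · rw [adjoin_simple_le_iff]
    exact inv_mem (mem_adjoin_simple_self ℂ a)
  · rw [adjoin_simple_le_iff]
    have := inv_mem (mem_adjoin_simple_self ℂ a⁻¹)
    rwa [inv_inv] at this

variable {L : Type*} [Field L] [Algebra ℂ L]

lemma transcendental_sub_algebraMap {a : L} (ha : Transcendental ℂ a) (c : ℂ) :
    Transcendental ℂ (a - algebraMap ℂ L c) := by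
  intro h
  have := h.add (isAlgebraic_algebraMap c)
  rw [sub_add_cancel] at this
  exact ha this

lemma transcendental_inv {a : L} (ha : Transcendental ℂ a) : Transcendental ℂ a⁻¹ := by
  intro h
  have := h.inv
  rw [inv_inv] at this
  exact ha this

/-- The expansion at infinity of the rational functions of `x`. -/
def expandInf {x : L} (hx : Transcendental ℂ x) : ℂ⟮x⟯ →ₐ[ℂ] HahnSeries ℚ ℂ :=
  (IntermediateField.val _).comp
    ((RatFunc.algEquivOfTranscendental x hx).symm.trans
      (RatFunc.algEquivOfTranscendental xInf (transcendental_xSeries _)) :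
        ℂ⟮x⟯ →ₐ[ℂ] ℂ⟮xInf⟯)

lemma expandInf_coeffHom {x : L} (hx : Transcendental ℂ x) (p : Polynomial ℂ) :
    expandInf hx (coeffHom x p) = Polynomial.aeval xInf p := by
  change expandInf hx (Polynomial.aeval (AdjoinSimple.gen ℂ x) p) = _
  rw [← Polynomial.aeval_algHom_apply]
  congr 2
  simp only [expandInf, AlgHom.comp_apply]
  change (((RatFunc.algEquivOfTranscendental xInf (transcendental_xSeries _))
    ((RatFunc.algEquivOfTranscendental x hx).symm (AdjoinSimple.gen ℂ x)) : ℂ⟮xInf⟯) :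
      HahnSeries ℚ ℂ) = xInf
  rw [RatFunc.algEquivOfTranscendental_symm_gen, RatFunc.algEquivOfTranscendental_X]

/-- The norm is `p / q` with `deg p ≤ [L : ℂ(f)]`, and its order at infinity is `deg q - deg p`.
This stands in for the fact that `f` has at most `[L : ℂ(f)]` poles over `x = ∞`. -/
lemma neg_finrank_le_order_norm {x f : L} (hx : Transcendental ℂ x) [FiniteDimensional ℂ⟮x⟯ L]
    (hf : Transcendental ℂ f) :
    -(Module.finrank ℂ⟮f⟯ L : ℚ) ≤ (expandInf hx (Algebra.norm ℂ⟮x⟯ f)).order := by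
  obtain ⟨p, q, hq, hpd, hpq⟩ := exists_norm_eq hx hf
  have hf0 : f ≠ 0 := by
    rintro rfl
    exact hf isAlgebraic_zero
  have hN : Algebra.norm ℂ⟮x⟯ f ≠ 0 := Algebra.norm_ne_zero_iff.2 hf0
  have hp : p ≠ 0 := by
    rintro rfl
    rw [map_zero, mul_eq_zero, map_eq_zero_iff _ (coeffHom_injective hx)] at hpq
    exact hpq.elim hN hq
  have h := congrArg (fun z => (expandInf hx z).order) hpq
  simp only [map_mul, expandInf_coeffHom] at h
  have hq' : Polynomial.aeval xInf q ≠ 0 := fun h0 => transcendental_xSeries _ ⟨q, hq, h0⟩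
  rw [HahnSeries.order_mul ((map_ne_zero (expandInf hx)).2 hN) hq', order_aeval_xInf hp,
    order_aeval_xInf hq] at h
  have h1 : (p.natDegree : ℚ) ≤ Module.finrank ℂ⟮f⟯ L := by exact_mod_cast hpd
  have h2 : (0 : ℚ) ≤ q.natDegree := Nat.cast_nonneg _
  linarith

/-- Under each of the `[L : ℂ(x)]` embeddings into Hahn series at infinity, the orders of `y - c₁`
and `1/y' - c₂` add up to at most `-1`. Summed over all embeddings they give the orders of two
norms, bounded below by `neg_finrank_le_order_norm`. -/
lemma finrank_adjoin_x_le (D : Derivation ℂ L L) {x y : L} (hDx : D x = 1)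
    (hDy : Transcendental ℂ (D y)) {G : MvPolynomial (Fin 2) ℂ} (hx : Transcendental ℂ x)
    (hy : Transcendental ℂ y) [FiniteDimensional ℂ⟮x⟯ L]
    (hG : Irreducible G) (hGy : aeval ![x, y] G = 0) :
    Module.finrank ℂ⟮x⟯ L ≤ Module.finrank ℂ⟮y⟯ L + Module.finrank ℂ⟮D y⟯ L := by
  let _ : Algebra ℂ⟮x⟯ (HahnSeries ℚ ℂ) := (expandInf hx).toRingHom.toAlgebra
  have hmap : ∀ z : ℂ⟮x⟯, algebraMap ℂ⟮x⟯ (HahnSeries ℚ ℂ) z = expandInf hx z := fun _ => rfl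
  have hchar : CharZero ℂ⟮x⟯ := charZero_of_injective_algebraMap (algebraMap ℂ ℂ⟮x⟯).injective
  have hσc : ∀ (σ : L →ₐ[ℂ⟮x⟯] HahnSeries ℚ ℂ) (c : ℂ),
      σ (algebraMap ℂ L c) = algebraMap ℂ (HahnSeries ℚ ℂ) c := fun σ c => by
    rw [IsScalarTower.algebraMap_apply ℂ ℂ⟮x⟯ L, σ.commutes, hmap, AlgHom.commutes]
  have hσx : ∀ σ : L →ₐ[ℂ⟮x⟯] HahnSeries ℚ ℂ, σ x = xInf := fun σ => by
    have h := σ.commutes (AdjoinSimple.gen ℂ x)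
    have h2 := expandInf_coeffHom hx Polynomial.X
    rw [AdjoinSimple.algebraMap_gen, hmap] at h
    rw [Polynomial.aeval_X] at h2
    rw [h, ← h2]
    congr 1
    exact (Polynomial.aeval_X _).symm
  have hσF : ∀ (σ : L →ₐ[ℂ⟮x⟯] HahnSeries ℚ ℂ) (F : MvPolynomial (Fin 2) ℂ),
      σ (aeval ![x, y] F) = aeval ![xInf, σ y] F := fun σ F => by
    let τ : L →ₐ[ℂ] HahnSeries ℚ ℂ := { σ.toRingHom with commutes' := hσc σ }
    have h := map_aeval_pair τ x y F
    have hx : τ x = xInf := hσx σ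
    rwa [hx] at h
  -- Both sides solve the linear equation obtained by differentiating the algebraic relation `G`,
  -- whose coefficient `∂G/∂Y` is non-zero.
  have hσD : ∀ σ : L →ₐ[ℂ⟮x⟯] HahnSeries ℚ ℂ, σ (D y) = ddx OnePoint.infty (σ y) := fun σ => by
    have h1 := derivation_aeval_pair D x y G
    rw [hGy, map_zero, hDx] at h1
    have h2 := congrArg σ h1
    rw [map_zero, map_add, map_mul, map_mul, map_one, hσF, hσF] at h2
    have h3 := derivation_aeval_pair (ddxDer OnePoint.infty) xInf (σ y) G
    rw [← hσF, hGy, map_zero, map_zero, ddxDer_xSeries] at h3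
    have h4 : aeval ![xInf, σ y] (pderiv 1 G) ≠ 0 := by
      rw [← hσF, map_ne_zero]
      exact pderiv_one_aeval_ne_zero hx hG hGy
    rw [← ddxDer_apply]
    apply mul_left_cancel₀ h4
    rw [h2] at h3
    exact add_left_cancel h3
  -- The finitely many embeddings exclude only finitely many values, so `c₁` and `c₂` can be generic
  -- for all of them at once.
  obtain ⟨c₁, hc₁⟩ := Infinite.exists_notMem_finset
    (Finset.univ.image fun σ : L →ₐ[ℂ⟮x⟯] HahnSeries ℚ ℂ => (σ y).coeff 0)
  obtain ⟨c₂, hc₂⟩ := Infinite.exists_notMem_finset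
    (Finset.univ.image fun σ : L →ₐ[ℂ⟮x⟯] HahnSeries ℚ ℂ => (σ (D y)⁻¹).coeff 0)
  have hc₁' : ∀ σ : L →ₐ[ℂ⟮x⟯] HahnSeries ℚ ℂ, c₁ ≠ (σ y).coeff 0 := fun σ h =>
    hc₁ (Finset.mem_image.2 ⟨σ, Finset.mem_univ _, h.symm⟩)
  have hc₂' : ∀ σ : L →ₐ[ℂ⟮x⟯] HahnSeries ℚ ℂ, c₂ ≠ (σ (D y)⁻¹).coeff 0 := fun σ h =>
    hc₂ (Finset.mem_image.2 ⟨σ, Finset.mem_univ _, h.symm⟩)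
  have hDy0 : D y ≠ 0 := by
    intro h
    rw [h] at hDy
    exact hDy isAlgebraic_zero
  have hf₁ := transcendental_sub_algebraMap hy c₁
  have hf₂ := transcendental_sub_algebraMap (transcendental_inv hDy) c₂
  have hb₁ := neg_finrank_le_order_norm hx hf₁
  have hb₂ := neg_finrank_le_order_norm hx hf₂
  rw [adjoin_simple_sub_algebraMap] at hb₁
  rw [adjoin_simple_sub_algebraMap, adjoin_simple_inv] at hb₂
  have horder : ∀ f : L, f ≠ 0 → (expandInf hx (Algebra.norm ℂ⟮x⟯ f)).order =
      ∑ σ : L →ₐ[ℂ⟮x⟯] HahnSeries ℚ ℂ, (σ f).order := fun f hf => by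
    rw [← hmap, Algebra.norm_eq_prod_embeddings, order_prod_eq]
    exact fun σ _ => (map_ne_zero σ).2 hf
  have hne : ∀ f : L, Transcendental ℂ f → f ≠ 0 := by
    rintro f hf rfl
    exact hf isAlgebraic_zero
  rw [horder _ (hne _ hf₁)] at hb₁
  rw [horder _ (hne _ hf₂)] at hb₂
  have hsum : ∑ σ : L →ₐ[ℂ⟮x⟯] HahnSeries ℚ ℂ, ((σ (y - algebraMap ℂ L c₁)).order +
      (σ ((D y)⁻¹ - algebraMap ℂ L c₂)).order) ≤
      ∑ σ : L →ₐ[ℂ⟮x⟯] HahnSeries ℚ ℂ, (-1 : ℚ) := by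
    refine Finset.sum_le_sum fun σ _ => ?_
    have h1 := hc₂' σ
    have hne := (map_ne_zero σ).2 hDy0
    rw [map_inv₀, hσD] at h1
    rw [hσD] at hne
    rw [map_sub, map_sub, hσc, hσc, map_inv₀, hσD]
    exact order_add_order_le hne (hc₁' σ) h1
  rw [Finset.sum_add_distrib, Finset.sum_const, Finset.card_univ, AlgHom.card] at hsum
  have : (Module.finrank ℂ⟮x⟯ L : ℚ) ≤ Module.finrank ℂ⟮y⟯ L + Module.finrank ℂ⟮D y⟯ L := by
    rw [nsmul_eq_mul] at hsum
    linarith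
  exact_mod_cast this

/-- The degree bounds for an algebraic solution of the autonomous equation `P(y, y') = 0`. -/
theorem degree_bounds (D : Derivation ℂ L L)
    (hconst : ∀ z, D z = 0 → ∃ c : ℂ, algebraMap ℂ L c = z) {x y : L} (hDx : D x = 1)
    (hDy : D y ≠ 0) (htop : ℂ⟮x, y⟯ = ⊤) {G P : MvPolynomial (Fin 2) ℂ}
    (hG : Irreducible G) (hGy : aeval ![x, y] G = 0)
    (hP : Irreducible P) (hPy : aeval ![y, D y] P = 0) :
    G.degreeOf 0 = P.degreeOf 1 ∧ G.degreeOf 1 ≤ P.degreeOf 0 + P.degreeOf 1 := by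
  have hx : Transcendental ℂ x :=
    transcendental_of_derivation_ne_zero D (by rw [hDx]; exact one_ne_zero)
  have hy : Transcendental ℂ y := transcendental_of_derivation_ne_zero D hDy
  have htop' := adjoin_derivation_eq_top D hconst hDx hDy htop hG hGy hP hPy
  have h0 : G.degreeOf 0 = P.degreeOf 1 := by
    rw [← finrank_eq_degreeOf_zero hy hG hGy htop, finrank_eq_degreeOf_one hy hP hPy htop']
  refine ⟨h0, ?_⟩
  have hn := finrank_eq_degreeOf_one hx hG hGy htop
  have hfin : FiniteDimensional ℂ⟮x⟯ L := by
    apply Module.finite_of_finrank_pos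
    rw [hn]
    exact Nat.pos_of_ne_zero (degreeOf_one_ne_zero hx hG.ne_zero hGy)
  by_cases hDy' : Transcendental ℂ (D y)
  · have h1 := finrank_adjoin_x_le D hDx hDy' hx hy hG hGy
    rw [hn, finrank_eq_degreeOf_one hy hP hPy htop',
      finrank_eq_degreeOf_zero hDy' hP hPy htop'] at h1
    omega
  -- If `y'` is constant then `y = αx + β` and `L = ℂ(x)`, so `deg_Y G = 1`, while `P` has positive
  -- degree in `y'`.
  · obtain ⟨α, hα⟩ := isAlgebraic_iff_mem_range.1 (not_not.1 hDy')
    obtain ⟨β, hβ⟩ := hconst (y - algebraMap ℂ L α * x) (by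
      rw [map_sub, D.leibniz, hDx, D.map_algebraMap, ← hα]; simp)
    have hyx : y ∈ ℂ⟮x⟯ := by
      have : y = algebraMap ℂ L β + algebraMap ℂ L α * x := by rw [hβ]; ring
      rw [this]
      exact add_mem (IntermediateField.algebraMap_mem _ _)
        (mul_mem (IntermediateField.algebraMap_mem _ _) (mem_adjoin_simple_self ℂ x))
    have hxtop : ℂ⟮x⟯ = ⊤ := by
      rw [eq_top_iff, ← htop, adjoin_le_iff]
      rintro s (rfl | rfl)
      · exact mem_adjoin_simple_self ℂ _
      · exact hyx
    rw [← hn, hxtop, IntermediateField.finrank_top]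
    have := degreeOf_one_ne_zero hy hP.ne_zero hPy
    omega

end DegreeBounds

/-! ## Degree bounds for algebraic Hahn series solutions -/

section Series

open IntermediateField

lemma ddx_ne_zero (x₀ : OnePoint ℂ) {y : HahnSeries ℚ ℂ} (hy : ∀ c : ℂ, y ≠ HahnSeries.C c) :
    ddxDer x₀ y ≠ 0 := by
  intro h
  obtain ⟨c, hc⟩ := exists_eq_C_of_ddxDer_eq_zero x₀ h
  rw [algebraMap_hahnSeries_apply] at hc
  exact hy c hc.symm

lemma exists_isMinimalPolynomial {x₀ : OnePoint ℂ} {y : HahnSeries ℚ ℂ}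
    (halg : IsAlgebraicSeries x₀ y) : ∃ G, IsMinimalPolynomial x₀ y G :=
  exists_irreducible_of_isAlgebraic (transcendental_xSeries x₀) halg

lemma adjoin_pair_eq_top {L : Type*} [Field L] [Algebra ℂ L] {a b : L} {E : IntermediateField ℂ L}
    (hE : E = ℂ⟮a, b⟯) (ha : a ∈ E) (hb : b ∈ E) : ℂ⟮(⟨a, ha⟩ : E), (⟨b, hb⟩ : E)⟯ = ⊤ := by
  apply IntermediateField.lift_injective E
  rw [lift_adjoin, lift_top, Set.image_pair]
  exact hE.symm

/-- The count of degrees takes place in `ℂ(x, y)`, which is closed under `d/dx`: differentiating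
`G(x, y) = 0` puts `y'` into it. -/
theorem IsMinimalPolynomial.degree_bounds {x₀ : OnePoint ℂ} {y : HahnSeries ℚ ℂ}
    (hy : ddxDer x₀ y ≠ 0) {G P : MvPolynomial (Fin 2) ℂ} (hG : IsMinimalPolynomial x₀ y G)
    (hP : Irreducible P) (hPy : aeval ![y, ddxDer x₀ y] P = 0) :
    G.degreeOf 0 = P.degreeOf 1 ∧ G.degreeOf 1 ≤ P.degreeOf 0 + P.degreeOf 1 := by
  obtain ⟨hGi, hGy⟩ := hG
  set x := xSeries x₀ with hxdef
  have hDx : ddxDer x₀ x = 1 := ddxDer_xSeries x₀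
  obtain ⟨E, hE⟩ : ∃ E : IntermediateField ℂ (HahnSeries ℚ ℂ), E = ℂ⟮x, y⟯ := ⟨_, rfl⟩
  have hxE : x ∈ E := by rw [hE]; exact subset_adjoin _ _ (by simp)
  have hyE : y ∈ E := by rw [hE]; exact subset_adjoin _ _ (by simp)
  have hval : ∀ (a b : E) (F : MvPolynomial (Fin 2) ℂ),
      ((aeval ![a, b] F : E) : HahnSeries ℚ ℂ) = aeval ![(a : HahnSeries ℚ ℂ), (b : HahnSeries ℚ ℂ)] F :=
    fun a b F => map_aeval_pair (IntermediateField.val E) a b F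
  have hDyE : ddxDer x₀ y ∈ E := by
    have h1 := derivation_aeval_pair (ddxDer x₀) x y G
    rw [hGy, map_zero, hDx, mul_one] at h1
    have h2 : aeval ![x, y] (pderiv 1 G) ≠ 0 :=
      pderiv_one_aeval_ne_zero (transcendental_xSeries x₀) hGi hGy
    have h3 : ddxDer x₀ y = -(aeval ![x, y] (pderiv 0 G)) * (aeval ![x, y] (pderiv 1 G))⁻¹ := by
      rw [eq_mul_inv_iff_mul_eq₀ h2]
      linear_combination -h1
    rw [h3]
    have hmem : ∀ F : MvPolynomial (Fin 2) ℂ, aeval ![x, y] F ∈ E := fun F =>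
      hval ⟨x, hxE⟩ ⟨y, hyE⟩ F ▸ Subtype.prop _
    exact mul_mem (neg_mem (hmem _)) (inv_mem (hmem _))
  have hclosed : ∀ z ∈ E, ddxDer x₀ z ∈ E := by
    intro z hz
    rw [hE] at hz hDyE ⊢
    refine derivation_mem_adjoin (ddxDer x₀) ?_ hz
    rintro s (rfl | rfl)
    · rw [hDx]; exact one_mem _
    · exact hDyE
  refine AutonomousODE.degree_bounds (L := E) (restrictDer (ddxDer x₀) E hclosed) ?_
    (x := ⟨x, hxE⟩) (y := ⟨y, hyE⟩) (Subtype.ext hDx) ?_ (adjoin_pair_eq_top hE hxE hyE) hGi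
    (Subtype.ext ?_) hP (Subtype.ext ?_)
  · intro z hz
    obtain ⟨c, hc⟩ := exists_eq_C_of_ddxDer_eq_zero x₀ (congrArg Subtype.val hz)
    exact ⟨c, Subtype.ext hc⟩
  · intro h
    exact hy (congrArg Subtype.val h)
  · rw [hval]; exact hGy
  · rw [hval]; exact hPy

lemma IsExpansionOf.exists_isMinimalPolynomial {x₀ : OnePoint ℂ} {y : HahnSeries ℚ ℂ}
    {r : RatFunc ℂ} (hr : IsExpansionOf x₀ y r) :
    ∃ G, IsMinimalPolynomial x₀ y G ∧ max r.num.natDegree r.denom.natDegree ≤ G.degreeOf 0 := by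
  have hd0 : Polynomial.aeval (xSeries x₀) r.denom ≠ 0 := fun h =>
    transcendental_xSeries x₀ ⟨_, r.denom_ne_zero, h⟩
  -- The polynomial `denom · Y - num` is linear in `Y` with coprime coefficients, hence irreducible.
  let q : Polynomial (Polynomial ℂ) := Polynomial.C r.denom * Polynomial.X + Polynomial.C (-r.num)
  have hq : Irreducible q := Polynomial.irreducible_C_mul_X_add_C r.denom_ne_zero
    (r.isCoprime_num_denom.symm.neg_right).isRelPrime
  let G := Polynomial.Bivariate.equivMvPolynomial ℂ q
  have hGq : asPolyY G = q := AlgEquiv.symm_apply_apply _ _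
  have heval : ∀ c : ℂ, aeval ![Polynomial.X, Polynomial.C c] G =
      r.denom * Polynomial.C c - r.num := fun c => by
    rw [aeval_eq_eval₂_asPolyY, hGq]
    simp [q, Polynomial.eval₂_add, Polynomial.eval₂_mul, sub_eq_add_neg]
  refine ⟨G, ⟨(MulEquiv.irreducible_iff (Polynomial.Bivariate.equivMvPolynomial ℂ)).2 hq, ?_⟩, ?_⟩
  · rw [aeval_eq_eval₂_asPolyY, hGq, hr]
    simp only [q, Polynomial.eval₂_add, Polynomial.eval₂_mul, Polynomial.eval₂_C,
      Polynomial.eval₂_X, Polynomial.eval₂_neg, AlgHom.toRingHom_eq_coe, RingHom.coe_coe, map_neg]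
    rw [mul_div_cancel₀ _ hd0, add_neg_cancel]
  -- Setting `Y = 0` and `Y = 1` bounds the degrees of `num` and `denom - num`, hence that of
  -- `denom`.
  · have h0 := natDegree_aeval_X_C_le G 0
    have h1 := natDegree_aeval_X_C_le G 1
    rw [heval] at h0 h1
    rw [Polynomial.C_0, mul_zero, zero_sub, Polynomial.natDegree_neg] at h0
    rw [Polynomial.C_1, mul_one] at h1
    refine max_le h0 ?_
    rw [← sub_add_cancel r.denom r.num]
    exact Polynomial.natDegree_add_le_of_degree_le h1 h0

end Series

/-! ## Specialisation of the rational functions `B_j` -/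

section Specialisation

lemma derivation_aeval_totalDeriv {L : Type*} [Field L] [Algebra ℂ L] (D : Derivation ℂ L L)
    {f : ℕ → L} (hf : ∀ i, D (f i) = f (i + 1)) (F : MvPolynomial ℕ ℂ) :
    D (aeval f F) = aeval f (totalDeriv F) := by
  induction F using MvPolynomial.induction_on with
  | C c =>
    rw [← MvPolynomial.algebraMap_eq, totalDeriv.map_algebraMap, AlgHom.commutes,
      D.map_algebraMap, map_zero]
  | add p q hp hq => simp only [map_add, hp, hq]
  | mul_X p i hp =>
    have h : totalDeriv (X i) = X (i + 1) := mkDerivation_X _ _ _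
    rw [map_mul, aeval_X, D.leibniz, totalDeriv.leibniz, h, hp, hf]
    simp

lemma derivation_iterate_aeval {L : Type*} [Field L] [Algebra ℂ L] (D : Derivation ℂ L L)
    {f : ℕ → L} (hf : ∀ i, D (f i) = f (i + 1)) (F : MvPolynomial ℕ ℂ) (k : ℕ) :
    D^[k] (aeval f F) = aeval f (totalDeriv^[k] F) := by
  induction k generalizing F with
  | zero => rfl
  | succ k ih => rw [Function.iterate_succ_apply, Function.iterate_succ_apply,
      derivation_aeval_totalDeriv D hf, ih]

lemma totalDeriv_mem_supported {F : MvPolynomial ℕ ℂ} {n : ℕ}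
    (hF : F ∈ supported ℂ {i | i < n}) : totalDeriv F ∈ supported ℂ {i | i < n + 1} := by
  have hmono : supported ℂ {i | i < n} ≤ supported ℂ {i | i < n + 1} :=
    supported_mono fun i (hi : i < n) => (Nat.lt_succ_of_lt hi : i < n + 1)
  rw [supported_eq_adjoin_X] at hF
  induction hF using Algebra.adjoin_induction with
  | mem p hp =>
    obtain ⟨i, hi, rfl⟩ := hp
    have h : totalDeriv (X i) = X (i + 1) := mkDerivation_X _ _ _
    rw [h, X_mem_supported]
    exact Nat.succ_lt_succ hi
  | algebraMap c => rw [totalDeriv.map_algebraMap]; exact zero_mem _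
  | add p q _ _ hp hq => rw [map_add]; exact add_mem hp hq
  | mul p q hp' hq' hp hq =>
    rw [← supported_eq_adjoin_X] at hp' hq'
    rw [totalDeriv.leibniz]
    exact add_mem (mul_mem (hmono hp') hq) (mul_mem (hmono hq') hp)

lemma rename_val_mem_supported (g : MvPolynomial (Fin 2) ℂ) :
    rename Fin.val g ∈ supported ℂ {i : ℕ | i < 2} := by
  induction g using MvPolynomial.induction_on with
  | C c => rw [rename_C]; exact Subalgebra.algebraMap_mem _ c
  | add p q hp hq => rw [map_add]; exact add_mem hp hq
  | mul_X p i hp =>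
    rw [map_mul, rename_X]
    exact mul_mem hp (X_mem_supported.2 i.2)

lemma totalDeriv_rename_val (g : MvPolynomial (Fin 2) ℂ) :
    totalDeriv (rename Fin.val g) =
      rename Fin.val (pderiv 0 g) * X 1 + rename Fin.val (separant g) * X 2 := by
  have h : ∀ i, totalDeriv (X i) = X (i + 1) := mkDerivation_X _ _
  unfold separant
  induction g using MvPolynomial.induction_on with
  | C c =>
    rw [rename_C, ← MvPolynomial.algebraMap_eq, totalDeriv.map_algebraMap]
    simp
  | add p q hp hq => simp only [map_add, hp, hq]; ring
  | mul_X p i hp =>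
    rw [map_mul, totalDeriv.leibniz, hp, rename_X, h]
    fin_cases i <;> simp [Derivation.leibniz, pderiv_X] <;> ring

/-- Induction through `R_(k+1) = R_k' + S' y^(k+1)`, with `S` the separant: the terms in `y^(k+2)`
cancel. It makes the default value `0` in `ratB` harmless. -/
lemma rittRem_mem_supported (g : MvPolynomial (Fin 2) ℂ) (n : ℕ) :
    rittRem g (n + 2) ∈ supported ℂ {i | i < n + 2} := by
  have hX : ∀ i, totalDeriv (X i) = X (i + 1) := mkDerivation_X _ _
  have hmono : ∀ {a b : ℕ}, a ≤ b → supported ℂ {i | i < a} ≤ supported ℂ {i | i < b} :=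
    fun hab => supported_mono fun i (hi : i < _) => (hi.trans_le hab : i < _)
  induction n with
  | zero =>
    have : rittRem g (0 + 2) = rename Fin.val (pderiv 0 g) * X 1 := by
      change totalDeriv (rename Fin.val g) - rename Fin.val (separant g) * X 2 = _
      rw [totalDeriv_rename_val, add_sub_cancel_right]
    rw [this]
    exact mul_mem (rename_val_mem_supported _) (X_mem_supported.2 (by simp))
  | succ n ih =>
    have h1 : rittRem g (n + 1 + 2) =
        totalDeriv (rittRem g (n + 2)) + totalDeriv (rename Fin.val (separant g)) * X (n + 2) := by
      have h2 : totalDeriv^[n + 1 + 2 - 1] (rename Fin.val g) =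
          totalDeriv (totalDeriv^[n + 2 - 1] (rename Fin.val g)) :=
        Function.iterate_succ_apply' _ _ _
      rw [rittRem, h2, rittRem, map_sub, totalDeriv.leibniz, hX, smul_eq_mul, smul_eq_mul]
      ring
    rw [h1]
    refine add_mem (totalDeriv_mem_supported ih) (mul_mem ?_ (X_mem_supported.2 (by simp)))
    exact hmono (by omega) (totalDeriv_mem_supported (rename_val_mem_supported _))

lemma aeval_congr_of_mem_supported {σ A : Type*} [CommRing A] [Algebra ℂ A] {s : Set σ}
    {F : MvPolynomial σ ℂ} (hF : F ∈ supported ℂ s) {f g : σ → A} (h : ∀ i ∈ s, f i = g i) :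
    aeval f F = aeval g F := by
  rw [supported_eq_adjoin_X] at hF
  induction hF using Algebra.adjoin_induction with
  | mem p hp =>
    obtain ⟨i, hi, rfl⟩ := hp
    rw [aeval_X, aeval_X, h i hi]
  | algebraMap c => rw [AlgHom.commutes, AlgHom.commutes]
  | add p q _ _ hp hq => rw [map_add, map_add, hp, hq]
  | mul p q _ _ hp hq => rw [map_mul, map_mul, hp, hq]

variable {L : Type*} [Field L] [Algebra ℂ L]

/-- The rational function `r` is defined at `(a, b)`, with value `z`. -/
def HasValueAt (a b : L) (r : RatUV) (z : L) : Prop :=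
  ∃ n d : MvPolynomial (Fin 2) ℂ, aeval ![a, b] d ≠ 0 ∧
    r * algebraMap _ RatUV d = algebraMap _ RatUV n ∧ aeval ![a, b] n = z * aeval ![a, b] d

variable {a b : L}

lemma hasValueAt_algebraMap (F : MvPolynomial (Fin 2) ℂ) :
    HasValueAt a b (algebraMap _ RatUV F) (aeval ![a, b] F) :=
  ⟨F, 1, by simp, by simp, by simp⟩

lemma HasValueAt.add {r s : RatUV} {z w : L} (hr : HasValueAt a b r z) (hs : HasValueAt a b s w) :
    HasValueAt a b (r + s) (z + w) := by
  obtain ⟨n, d, hd, h1, h2⟩ := hr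
  obtain ⟨n', d', hd', h1', h2'⟩ := hs
  refine ⟨n * d' + n' * d, d * d', ?_, ?_, ?_⟩
  · rw [map_mul]; exact mul_ne_zero hd hd'
  · rw [map_mul, map_add, map_mul, map_mul, ← h1, ← h1']; ring
  · rw [map_add, map_mul, map_mul, map_mul, h2, h2']; ring

lemma HasValueAt.mul {r s : RatUV} {z w : L} (hr : HasValueAt a b r z) (hs : HasValueAt a b s w) :
    HasValueAt a b (r * s) (z * w) := by
  obtain ⟨n, d, hd, h1, h2⟩ := hr
  obtain ⟨n', d', hd', h1', h2'⟩ := hs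
  refine ⟨n * n', d * d', ?_, ?_, ?_⟩
  · rw [map_mul]; exact mul_ne_zero hd hd'
  · rw [map_mul, map_mul, ← h1, ← h1']; ring
  · rw [map_mul, map_mul, h2, h2']; ring

lemma HasValueAt.neg {r : RatUV} {z : L} (hr : HasValueAt a b r z) : HasValueAt a b (-r) (-z) := by
  obtain ⟨n, d, hd, h1, h2⟩ := hr
  refine ⟨-n, d, hd, ?_, ?_⟩
  · rw [map_neg, ← h1, neg_mul]
  · rw [map_neg, h2, neg_mul]

lemma HasValueAt.div {r : RatUV} {z : L} (hr : HasValueAt a b r z) {F : MvPolynomial (Fin 2) ℂ}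
    (hF : aeval ![a, b] F ≠ 0) :
    HasValueAt a b (r / algebraMap _ RatUV F) (z / aeval ![a, b] F) := by
  obtain ⟨n, d, hd, h1, h2⟩ := hr
  have hF0 : algebraMap _ RatUV F ≠ 0 := by
    rw [Ne, FaithfulSMul.algebraMap_eq_zero_iff]
    rintro rfl
    exact hF (map_zero _)
  refine ⟨n, d * F, ?_, ?_, ?_⟩
  · rw [map_mul]; exact mul_ne_zero hd hF
  · rw [map_mul, ← h1]; field_simp
  · rw [map_mul, h2]; field_simp

lemma HasValueAt.aeval {σ : Type*} {f : σ → RatUV} {z : σ → L} (h : ∀ i, HasValueAt a b (f i) (z i))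
    (F : MvPolynomial σ ℂ) : HasValueAt a b (aeval f F) (aeval z F) := by
  induction F using MvPolynomial.induction_on with
  | C c =>
    have := hasValueAt_algebraMap (a := a) (b := b) (C c)
    simp only [MvPolynomial.aeval_C] at this ⊢
    exact this
  | add p q hp hq => rw [map_add, map_add]; exact hp.add hq
  | mul_X p i hp => rw [map_mul, map_mul, aeval_X, aeval_X]; exact hp.mul (h i)

/-- Any fraction `n / d` for `r` satisfies `num · d = n · den`, so a numerator `n` vanishing where
`d` does not forces `num` to vanish. -/
lemma HasValueAt.aeval_num_eq_zero {r : RatUV} (hr : HasValueAt a b r 0) :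
    MvPolynomial.aeval ![a, b] (IsFractionRing.num (MvPolynomial (Fin 2) ℂ) r) = 0 := by
  obtain ⟨n, d, hd, h1, h2⟩ := hr
  have h3 := IsLocalization.mk'_spec RatUV (IsFractionRing.num (MvPolynomial (Fin 2) ℂ) r)
    (IsFractionRing.den (MvPolynomial (Fin 2) ℂ) r)
  rw [IsFractionRing.mk'_num_den] at h3
  have h4 : IsFractionRing.num (MvPolynomial (Fin 2) ℂ) r * d =
      n * (IsFractionRing.den (MvPolynomial (Fin 2) ℂ) r) := by
    apply FaithfulSMul.algebraMap_injective (MvPolynomial (Fin 2) ℂ) RatUV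
    rw [map_mul, map_mul, ← h3, ← h1]
    ring
  have h5 := congrArg (MvPolynomial.aeval ![a, b]) h4
  rw [map_mul, map_mul, h2, zero_mul, zero_mul] at h5
  exact (mul_eq_zero.1 h5).resolve_right hd

/-- Differentiating `g(y, y') = 0` repeatedly gives `S y^(n) + R_(n-1) = 0` at the solution, the
same recursion that defines `B_n`. -/
lemma hasValueAt_ratB (D : Derivation ℂ L L) {y : L} {g : MvPolynomial (Fin 2) ℂ}
    (hg : aeval ![y, D y] g = 0) (hs : aeval ![y, D y] (separant g) ≠ 0) (n : ℕ) :
    HasValueAt y (D y) (ratB g n) (D^[n] y) := by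
  have hval : ∀ F : MvPolynomial (Fin 2) ℂ,
      aeval (fun i => D^[i] y) (rename Fin.val F) = aeval ![y, D y] F := by
    intro F
    rw [aeval_rename]
    congr 2
    ext i
    fin_cases i <;> simp
  induction n using Nat.strong_induction_on with
  | _ n ih =>
    match n with
    | 0 =>
      have := hasValueAt_algebraMap (a := y) (b := D y) (X 0)
      rw [ratB]
      simpa using this
    | 1 =>
      have := hasValueAt_algebraMap (a := y) (b := D y) (X 1)
      rw [ratB]
      simpa using this
    | n + 2 =>
      have h1 : ∀ i, HasValueAt y (D y) (if _h : i < n + 2 then ratB g i else 0)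
          (if i < n + 2 then D^[i] y else 0) := by
        intro i
        split_ifs with h
        · exact ih i h
        · simpa using hasValueAt_algebraMap (a := y) (b := D y) 0
      have h2 := (HasValueAt.aeval h1 (rittRem g (n + 2))).neg.div hs
      rw [aeval_congr_of_mem_supported (rittRem_mem_supported g n)
        (f := fun i => if i < n + 2 then D^[i] y else 0) (g := fun i => D^[i] y) (fun i hi => if_pos hi)] at h2
      have h3 : aeval (fun i => D^[i] y) (rittRem g (n + 2)) =
          -(aeval ![y, D y] (separant g) * D^[n + 2] y) := by
        rw [rittRem, map_sub, map_mul, aeval_X, hval, ← derivation_iterate_aeval D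
          (f := fun i => D^[i] y) (fun i => (Function.iterate_succ_apply' _ _ _).symm), hval, hg]
        have h0 : ∀ k, D^[k] 0 = 0 := fun k => Function.iterate_fixed (map_zero D) k
        rw [h0, zero_sub]
      rw [h3, neg_neg, mul_div_cancel_left₀ _ hs] at h2
      rw [ratB]
      exact h2

end Specialisation

/-! ## The coordinate ring of a system with two independent coordinates -/

/-- Going up: chains of primes of the polynomial ring lift along the integral extension. -/
lemma natCast_le_ringKrullDim_of_injective_of_finite {s : ℕ} {A : Type*} [CommRing A]
    [IsDomain A] [Algebra ℂ A] (g : MvPolynomial (Fin s) ℂ →ₐ[ℂ] A) (hinj : Function.Injective g)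
    (hfin : g.Finite) : (s : WithBot ℕ∞) ≤ ringKrullDim A := by
  algebraize [g.toRingHom]
  have hinj' : Function.Injective (algebraMap (MvPolynomial (Fin s) ℂ) A) := hinj
  have : Module.Finite (MvPolynomial (Fin s) ℂ) A := hfin
  have : Algebra.IsIntegral (MvPolynomial (Fin s) ℂ) A := inferInstance
  have hs : (s : WithBot ℕ∞) ≤ ringKrullDim (MvPolynomial (Fin s) ℂ) := by
    rw [MvPolynomial.ringKrullDim_of_isNoetherianRing, ringKrullDim_eq_zero_of_field]
    simp
  refine hs.trans ?_
  refine iSup_le fun l => ?_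
  obtain ⟨P, hP, hPl⟩ := Ideal.exists_ideal_over_prime_of_isIntegral_of_isDomain
    (S := A) l.head.asIdeal (by
      rw [(RingHom.injective_iff_ker_eq_bot _).mp hinj']
      exact bot_le)
  have : P.LiesOver l.head.asIdeal := ⟨hPl.symm⟩
  obtain ⟨L, hL, -⟩ := Ideal.exists_ltSeries_of_hasGoingUp l P
  rw [← hL]
  exact le_iSup (fun p : LTSeries (PrimeSpectrum A) => (p.length : WithBot ℕ∞)) L

/-- In a Noether normalisation the number `s` of variables is the transcendence degree, hence at
least two. -/
lemma two_le_ringKrullDim_of_algebraicIndependent {A : Type} [CommRing A] [IsDomain A]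
    [Algebra ℂ A] [Algebra.FiniteType ℂ A] {x : Fin 2 → A} (hx : AlgebraicIndependent ℂ x) :
    2 ≤ ringKrullDim A := by
  obtain ⟨s, g, hinj, hfin⟩ := exists_finite_inj_algHom_of_fg ℂ A
  refine le_trans ?_ (natCast_le_ringKrullDim_of_injective_of_finite g hinj hfin)
  algebraize [g.toRingHom]
  have hinj' : Function.Injective (algebraMap (MvPolynomial (Fin s) ℂ) A) := hinj
  have : Module.Finite (MvPolynomial (Fin s) ℂ) A := hfin
  have : FaithfulSMul (MvPolynomial (Fin s) ℂ) A :=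
    (faithfulSMul_iff_algebraMap_injective _ _).mpr hinj'
  have h1 := hx.cardinalMk_le_trdeg
  rw [← trdeg_add_eq ℂ (MvPolynomial (Fin s) ℂ) (A := A),
    MvPolynomial.trdeg_of_isDomain, trdeg_eq_zero] at h1
  simp only [Cardinal.mk_fin, Cardinal.lift_natCast, add_zero, Nat.cast_le] at h1
  exact_mod_cast h1

variable {m : ℕ}

/-- By the Nullstellensatz the polynomials vanishing on the algebraic set also vanish at `b`, so the
coordinate ring maps onto the domain `ℂ[b]`. -/
lemma two_le_dimension {Ω : Type} [Field Ω] [Algebra ℂ Ω]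
    {S : Set (MvPolynomial (Fin (m + 1)) ℂ)} {b : Fin (m + 1) → Ω} (hb : b ∈ zeroSet Ω S)
    {e : Fin 2 → Fin (m + 1)} (he : AlgebraicIndependent ℂ (b ∘ e)) : 2 ≤ dimension S := by
  let φ : MvPolynomial (Fin (m + 1)) ℂ →ₐ[ℂ] Ω := aeval b
  have hfg : Algebra.FiniteType ℂ φ.range :=
    Algebra.FiniteType.of_surjective φ.rangeRestrict φ.rangeRestrict_surjective
  have hx : AlgebraicIndependent ℂ (fun i => φ.rangeRestrict (X (e i))) := by
    have : b ∘ e = φ.range.val ∘ fun i => φ.rangeRestrict (X (e i)) := by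
      funext i
      exact (aeval_X b (e i)).symm
    rw [this] at he
    exact he.of_comp φ.range.val
  refine (two_le_ringKrullDim_of_algebraicIndependent hx).trans ?_
  have hI : ∀ p ∈ vanishingIdeal ℂ (zeroLocus ℂ (Ideal.span S)), φ.rangeRestrict p = 0 := by
    intro p hp
    rw [vanishingIdeal_zeroLocus_eq_radical] at hp
    obtain ⟨n, hn⟩ := hp
    have h0 : Ideal.span S ≤ RingHom.ker φ.rangeRestrict := by
      refine Ideal.span_le.mpr fun F hF => ?_
      exact Subtype.ext (hb F hF)
    have := h0 hn
    rw [RingHom.mem_ker, map_pow] at this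
    exact eq_zero_of_pow_eq_zero this
  refine ringKrullDim_le_of_surjective
    (Ideal.Quotient.lift _ (φ.rangeRestrict : _ →+* φ.range) hI) ?_
  exact Ideal.Quotient.lift_surjective_of_surjective _ hI φ.rangeRestrict_surjective

/-! ## Elimination along a chain -/

lemma eval₂_asPoly {A : Type*} [CommRing A] [Algebra ℂ A] (i : Fin (m + 1)) (b : Fin (m + 1) → A)
    (β : A) (f : MvPolynomial (Fin (m + 1)) ℂ) :
    (asPoly i f).eval₂ (aeval (R := ℂ) b).toRingHom β = aeval (Function.update b i β) f := by
  induction f using MvPolynomial.induction_on with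
  | C c =>
    rw [← algebraMap_eq, AlgHom.commutes, AlgHom.commutes, Polynomial.algebraMap_apply,
      Polynomial.eval₂_C]
    exact AlgHom.commutes _ c
  | add p q hp hq => rw [map_add, map_add, Polynomial.eval₂_add, hp, hq]
  | mul_X p k hp =>
    rw [map_mul, map_mul, Polynomial.eval₂_mul, hp, aeval_X, asPoly, aeval_X]
    by_cases hk : k = i
    · subst hk
      simp
    · simp [hk]

lemma asPoly_injective (i : Fin (m + 1)) : Function.Injective (asPoly (m := m) i) := by
  intro f g h
  have h1 := eval₂_asPoly i (X : _ → MvPolynomial (Fin (m + 1)) ℂ) (X i) f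
  have h2 := eval₂_asPoly i (X : _ → MvPolynomial (Fin (m + 1)) ℂ) (X i) g
  rw [h, h2] at h1
  simpa using h1.symm

lemma aeval_congr_vars {A : Type*} [CommRing A] [Algebra ℂ A] {b b' : Fin (m + 1) → A}
    {f : MvPolynomial (Fin (m + 1)) ℂ} (h : ∀ k ∈ f.vars, b k = b' k) :
    aeval b f = aeval b' f :=
  eval₂Hom_congr' rfl (fun k hk _ => h k hk) rfl

/-- The coefficients of `f` in `y_j` are free of `y_i`. The hypothesis covers two cases: `y_i` does
not occur in `f`, or it is `y_j` itself. -/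
lemma map_asPoly {i j : Fin (m + 1)} {f : MvPolynomial (Fin (m + 1)) ℂ}
    (h : i ∈ f.vars → i = j) :
    (asPoly j f).map (asPoly i).toRingHom = (asPoly j f).map Polynomial.C := by
  refine hom_congr_vars (R := ℂ) (σ := Fin (m + 1))
    (S := Polynomial (Polynomial (MvPolynomial (Fin (m + 1)) ℂ)))
    (f₁ := (Polynomial.mapRingHom (asPoly i).toRingHom).comp (asPoly j).toRingHom)
    (f₂ := (Polynomial.mapRingHom Polynomial.C).comp (asPoly j).toRingHom) ?_
    (fun k hk _ => ?_) rfl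
  · ext c : 1
    have hc : ∀ l : Fin (m + 1), asPoly l (C c) = Polynomial.C (C c) :=
      fun l => (asPoly l).commutes c
    simp [hc]
  · have hX : ∀ l n : Fin (m + 1),
        asPoly l (X n) = if n = l then Polynomial.X else Polynomial.C (X n) :=
      fun l n => aeval_X _ n
    by_cases hkj : k = j
    · simp [hX, hkj]
    · have hki : k ≠ i := fun e => hkj (e.trans (h (e ▸ hk)))
      simp [hX, hkj, hki]

lemma asPoly_coeff {i j : Fin (m + 1)} {f : MvPolynomial (Fin (m + 1)) ℂ}
    (h : i ∈ f.vars → i = j) (n : ℕ) :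
    asPoly i ((asPoly j f).coeff n) = Polynomial.C ((asPoly j f).coeff n) := by
  have := congrArg (fun p => Polynomial.coeff p n) (map_asPoly h)
  simpa using this

lemma lv_mem_vars {F : MvPolynomial (Fin (m + 1)) ℂ} (hF : F.vars.Nonempty) : lv F ∈ F.vars := by
  obtain ⟨k, hk, h⟩ := Finset.exists_mem_eq_sup F.vars hF id
  rw [lv, h]
  exact hk

lemma le_lv {F : MvPolynomial (Fin (m + 1)) ℂ} {k : Fin (m + 1)} (hk : k ∈ F.vars) : k ≤ lv F :=
  Finset.le_sup (f := id) hk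

/-- In degree zero, substituting `0` for `y_i` would not change `F`, so `y_i` would not occur. -/
lemma natDegree_asPoly_ne_zero {i : Fin (m + 1)} {F : MvPolynomial (Fin (m + 1)) ℂ}
    (hi : i ∈ F.vars) : (asPoly i F).natDegree ≠ 0 := by
  intro h
  obtain ⟨c, hc⟩ := Polynomial.natDegree_eq_zero.mp h
  have h1 := eval₂_asPoly i (X : _ → MvPolynomial (Fin (m + 1)) ℂ) (X i) F
  have h2 := eval₂_asPoly i (X : _ → MvPolynomial (Fin (m + 1)) ℂ) 0 F
  rw [← hc, Polynomial.eval₂_C] at h1 h2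
  rw [h1, Function.update_eq_self, aeval_X_left_apply] at h2
  have h3 : i ∈ (bind₁ (Function.update X i 0) F).vars := by
    rw [h2] at hi
    exact hi
  obtain ⟨k, -, hk⟩ := mem_vars_bind₁ _ _ h3
  by_cases hki : k = i
  · subst hki
    simp at hk
  · rw [Function.update_of_ne hki, vars_X, Finset.mem_singleton] at hk
    exact hki hk.symm

lemma resChain_append (f F : MvPolynomial (Fin (m + 1)) ℂ)
    (T : List (MvPolynomial (Fin (m + 1)) ℂ)) :
    resChain f (T ++ [F]) = resChain (resVar (lv F) f F) T := by
  simp [resChain, List.foldr_append]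

/-- Resultants are multiplicative. Powers arise because the resultant of `F` with a polynomial free
of its leading variable is a power of that polynomial. -/
lemma resChain_pow_eq_zero {d : ℕ} (hd : d ≠ 0) (T : List (MvPolynomial (Fin (m + 1)) ℂ)) :
    ∀ c : MvPolynomial (Fin (m + 1)) ℂ, resChain c T = 0 → resChain (c ^ d) T = 0 := by
  induction T using List.reverseRecOn with
  | nil => intro c hc; exact (pow_eq_zero_iff hd).mpr hc
  | append_singleton T F ih =>
    intro c hc
    rw [resChain_append] at hc ⊢
    by_cases h0 : c = 0
    · rw [h0, zero_pow hd]
      rwa [h0] at hc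
    · have : resVar (lv F) (c ^ d) F = resVar (lv F) c F ^ d := by
        rw [resVar, map_pow]
        exact Polynomial.resultant_pow_left _ _ _ _
          (pow_ne_zero _ (Polynomial.leadingCoeff_ne_zero.mpr
            ((map_ne_zero_iff _ (asPoly_injective _)).mpr h0))) le_rfl
      rw [this]
      exact ih _ hc

lemma resVar_of_asPoly_eq_C {i : Fin (m + 1)} {c : MvPolynomial (Fin (m + 1)) ℂ}
    (hc : asPoly i c = Polynomial.C c) (F : MvPolynomial (Fin (m + 1)) ℂ) :
    resVar i c F = c ^ (asPoly i F).natDegree := by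
  rw [resVar, hc, Polynomial.natDegree_C]
  simp

/-- A regular chain has a zero whose coordinates at the non-leading variables are prescribed
algebraically independent elements, and at which no polynomial with non-vanishing iterated
resultant vanishes. -/
lemma IsRegularChain.exists_generic_zero {Ω : Type*} [Field Ω] [IsAlgClosed Ω] [Algebra ℂ Ω]
    {t : Fin (m + 1) → Ω} (ht : AlgebraicIndependent ℂ t)
    {T : List (MvPolynomial (Fin (m + 1)) ℂ)} (hT : IsRegularChain T) :
    ∃ b : Fin (m + 1) → Ω, (∀ i, (∀ F ∈ T, lv F ≠ i) → b i = t i) ∧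
      (∀ F ∈ T, aeval b F = 0) ∧ ∀ f, resChain f T ≠ 0 → aeval b f ≠ 0 := by
  induction T using List.reverseRecOn with
  | nil =>
    refine ⟨t, fun _ _ => rfl, by simp, fun f hf h => hf ?_⟩
    exact (map_eq_zero_iff _ (algebraicIndependent_iff_injective_aeval.mp ht)).mp h
  | append_singleton T F ih =>
    have hF : F.vars.Nonempty := hT.nonconstant F (by simp)
    have hlt : ∀ G ∈ T, lv G < lv F := fun G hG =>
      (List.pairwise_append.mp hT.triangular).2.2 G hG F (by simp)
    set i := lv F with hi
    have hd : (asPoly i F).natDegree ≠ 0 := natDegree_asPoly_ne_zero (lv_mem_vars hF)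
    -- The initials do not involve `y_i`, so elimination by `F` only raises them to a power, and
    -- regularity passes to the shorter chain.
    have hred : ∀ G, (i ∈ G.vars → i = lv G) → resChain (initial G) (T ++ [F]) ≠ 0 →
        resChain (initial G) T ≠ 0 := by
      intro G hG h h0
      rw [resChain_append, ← hi, resVar_of_asPoly_eq_C (c := initial G) (asPoly_coeff hG _)] at h
      exact h (resChain_pow_eq_zero hd T _ h0)
    have hfree : ∀ G ∈ T, i ∉ G.vars := fun G hG h => (le_lv h).not_gt (hlt G hG)
    have hT' : IsRegularChain T :=
      ⟨fun G hG => hT.nonconstant G (List.mem_append_left _ hG),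
        (List.pairwise_append.mp hT.triangular).1,
        fun G hG => hred G (fun h => absurd h (hfree G hG))
          (hT.regular G (List.mem_append_left _ hG))⟩
    obtain ⟨b, hb1, hb2, hb3⟩ := ih hT'
    have hinit : aeval b (initial F) ≠ 0 :=
      hb3 _ (hred F (fun _ => hi) (hT.regular F (by simp)))
    -- Since the initial of `F` does not vanish at `b`, specialisation keeps the positive degree in
    -- `y_i`, and a root `β` extends the zero.
    have hdeg : ((asPoly i F).map (aeval (R := ℂ) b).toRingHom).degree ≠ 0 := by
      intro h
      apply hd
      rw [← Polynomial.natDegree_map_of_leadingCoeff_ne_zero (aeval (R := ℂ) b).toRingHom hinit]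
      exact Polynomial.natDegree_eq_zero_iff_degree_le_zero.mpr h.le
    obtain ⟨β, hβ⟩ := IsAlgClosed.exists_root _ hdeg
    rw [Polynomial.IsRoot, Polynomial.eval_map, eval₂_asPoly] at hβ
    refine ⟨Function.update b i β, fun k hk => ?_, fun G hG => ?_, fun f hf h => ?_⟩
    · rw [Function.update_of_ne (fun e => hk F (by simp) e.symm)]
      exact hb1 k fun G hG => hk G (List.mem_append_left _ hG)
    · rcases List.mem_append.mp hG with hG | hG
      · rw [← hb2 G hG]
        exact aeval_congr_vars fun k hk =>
          Function.update_of_ne (fun e : k = i => hfree G hG (e ▸ hk)) _ _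
      · rwa [List.mem_singleton.mp hG]
    · rw [resChain_append] at hf
      -- The resultant is a combination of `f` and `F`, so a common zero of both would make it
      -- vanish at `b`.
      obtain ⟨p, q, -, -, hpq⟩ := Polynomial.exists_mul_add_mul_eq_C_resultant (asPoly i f)
        (asPoly i F) le_rfl le_rfl (Or.inr hd)
      have := congrArg (Polynomial.eval₂ (aeval (R := ℂ) b).toRingHom β) hpq
      rw [Polynomial.eval₂_add, Polynomial.eval₂_mul, Polynomial.eval₂_mul, eval₂_asPoly,
        eval₂_asPoly, hβ, h, zero_mul, zero_mul, zero_add, Polynomial.eval₂_C] at this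
      exact hb3 _ hf this.symm

/-- If the system has dimension one, then a chain of a regular chain decomposition has at most one
variable that is not a leading variable. -/
lemma IsRegularChainDecomposition.exists_lv_eq {S : Set (MvPolynomial (Fin (m + 1)) ℂ)}
    (hdim : dimension S = 1) {N : ℕ} {T : Fin N → List (MvPolynomial (Fin (m + 1)) ℂ)}
    (hT : IsRegularChainDecomposition S T) (k : Fin N) {i j : Fin (m + 1)} (hij : i ≠ j)
    (hi : ∀ F ∈ T k, lv F ≠ i) : ∃ F ∈ T k, lv F = j := by
  by_contra! hj
  let R := FractionRing (MvPolynomial (Fin (m + 1)) ℂ)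
  let Ω := AlgebraicClosure R
  let t : Fin (m + 1) → Ω := fun l => algebraMap (MvPolynomial (Fin (m + 1)) ℂ) Ω (X l)
  have hinj : Function.Injective (algebraMap (MvPolynomial (Fin (m + 1)) ℂ) Ω) := by
    rw [IsScalarTower.algebraMap_eq _ R Ω]
    exact (algebraMap R Ω).injective.comp (IsFractionRing.injective _ _)
  have ht : AlgebraicIndependent ℂ t := by
    refine AlgebraicIndependent.map' (f := IsScalarTower.toAlgHom ℂ _ Ω)
      (algebraicIndependent_X _ _) hinj
  obtain ⟨b, hb1, hb2, hb3⟩ := (hT.1 k).exists_generic_zero ht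
  -- The generic zero avoids the zeros of all initials, so the decomposition over `Ω` makes it a
  -- zero of the system.
  have hb : b ∈ zeroSet Ω S := by
    rw [hT.2 Ω]
    refine Set.mem_iUnion.mpr ⟨k, hb2, fun h => ?_⟩
    have h1 := h _ rfl
    rw [map_list_prod, List.prod_eq_zero_iff, List.map_map] at h1
    obtain ⟨F, hF, h2⟩ := List.mem_map.mp h1
    exact hb3 _ ((hT.1 k).regular F hF) h2
  have he : AlgebraicIndependent ℂ (b ∘ ![i, j]) := by
    have : b ∘ ![i, j] = t ∘ ![i, j] := by
      funext l
      fin_cases l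
      · exact hb1 i hi
      · exact hb1 j hj
    rw [this]
    refine ht.comp _ fun l l' h => ?_
    fin_cases l <;> fin_cases l' <;> simp_all
  have := two_le_dimension hb he
  rw [hdim] at this
  exact absurd this (by decide)

/-- A regular chain whose leading variables are exactly `y', …, y^(m)` consists of polynomials
`G₁(y, y'), …, G_m(y, …, y^(m))`. -/
lemma IsRegularChain.exists_isODEChain {T : List (MvPolynomial (Fin (m + 1)) ℂ)}
    (hT : IsRegularChain T) (h0 : ∀ F ∈ T, lv F ≠ 0) (h : ∀ j, j ≠ 0 → ∃ F ∈ T, lv F = j) :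
    ∃ G, IsODEChain T G := by
  have h1 : (T.map lv).Pairwise (· < ·) := List.pairwise_map.mpr hT.triangular
  have h2 : (List.ofFn (Fin.succ : Fin m → Fin (m + 1))).Pairwise (· < ·) :=
    List.pairwise_ofFn.mpr fun i j hij => Fin.succ_lt_succ_iff.mpr hij
  have h3 : T.map lv = List.ofFn (Fin.succ : Fin m → Fin (m + 1)) := by
    -- Two strictly increasing lists with the same members coincide.
    refine List.Perm.eq_of_pairwise' h1 h2 ((List.perm_ext_iff_of_nodup h1.nodup h2.nodup).2 ?_)
    intro j
    rw [List.mem_map, List.mem_ofFn]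
    constructor
    · rintro ⟨F, hF, rfl⟩
      exact Fin.exists_succ_eq.mpr (h0 F hF)
    · rintro ⟨i, rfl⟩
      exact h _ (Fin.succ_ne_zero i)
  have hlen : T.length = m := by simpa using congrArg List.length h3
  refine ⟨fun j => T[j.val]'(hlen.symm ▸ j.2), ?_, fun j => ⟨?_, ?_⟩⟩
  · exact List.ext_getElem (by simpa using hlen) (by simp)
  · exact hT.nonconstant _ (List.getElem_mem _)
  · have h4 := List.getElem_of_eq h3 (i := j.val) (by simp [hlen])
    simpa using h4

/-! ### From a solution of a chain to a common factor of the associated polynomials. -/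

/-- A polynomial with leading variable `y₀` would be an algebraic equation for `a 0` over `ℂ`. -/
lemma lv_ne_zero_of_transcendental {L : Type} [Field L] [Algebra ℂ L] {a : Fin (m + 1) → L}
    (ha : Transcendental ℂ (a 0)) {F : MvPolynomial (Fin (m + 1)) ℂ} (hF : F.vars.Nonempty)
    (h : aeval a F = 0) : lv F ≠ 0 := by
  intro h0
  let p : Polynomial ℂ := aeval (fun i : Fin (m + 1) => if i = 0 then Polynomial.X else 0) F
  have key : ∀ (A : Type) [CommRing A] [Algebra ℂ A] (b : Fin (m + 1) → A),
      Polynomial.aeval (b 0) p = aeval b F := by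
    intro A _ _ b
    rw [comp_aeval_apply]
    refine aeval_congr_vars fun k hk => ?_
    have : k = 0 := Fin.le_zero_iff.mp (h0 ▸ le_lv hk)
    simp [this]
  have hp : p ≠ 0 := by
    intro hp
    have := key _ (X : Fin (m + 1) → MvPolynomial (Fin (m + 1)) ℂ)
    rw [hp, map_zero, aeval_X_left_apply] at this
    rw [← this] at hF
    simp at hF
  exact ha ⟨p, hp, (key L a).trans h⟩

lemma aeval_toBiv [NeZero m] {F : MvPolynomial (Fin (m + 1)) ℂ} (hF : lv F ≤ 1)
    {A : Type*} [CommRing A] [Algebra ℂ A] (b : Fin (m + 1) → A) :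
    aeval ![b 0, b 1] (toBiv F) = aeval b F := by
  have h1 : ((1 : Fin (m + 1)) : ℕ) = 1 := by
    rw [Fin.val_one', Nat.mod_eq_of_lt]
    have := NeZero.pos m
    omega
  rw [toBiv, comp_aeval_apply]
  refine aeval_congr_vars fun k hk => ?_
  have hk1 : (k : ℕ) ≤ 1 := (Fin.le_def.mp ((le_lv hk).trans hF)).trans_eq h1
  rw [dif_pos (by omega), aeval_X]
  rcases Nat.le_one_iff_eq_zero_or_eq_one.mp hk1 with h | h
  · have e : (⟨k, by omega⟩ : Fin 2) = 0 := Fin.ext h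
    rw [e, show k = 0 from Fin.ext h]
    rfl
  · have e : (⟨k, by omega⟩ : Fin 2) = 1 := Fin.ext h
    rw [e, show k = 1 from Fin.ext (h.trans h1.symm)]
    rfl

lemma toBiv_ne_zero [NeZero m] {F : MvPolynomial (Fin (m + 1)) ℂ} (hF : lv F ≤ 1) (h0 : F ≠ 0) :
    toBiv F ≠ 0 := by
  intro h
  have := aeval_toBiv hF (X : Fin (m + 1) → MvPolynomial (Fin (m + 1)) ℂ)
  rw [h, map_zero, aeval_X_left_apply] at this
  exact h0 this.symm

section Field

variable {L : Type*} [Field L] [Algebra ℂ L]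

/-- Write `g = P Q`. At a zero of `P` the separant is `(∂P/∂u₁) Q`, and `Q` does not vanish there
because `P` is a simple factor. -/
lemma separant_aeval_ne_zero {a b : L} (ha : Transcendental ℂ a) {P g : MvPolynomial (Fin 2) ℂ}
    (hP : Irreducible P) (hP0 : aeval ![a, b] P = 0) (hPg : P ∣ g) (hg : Squarefree g) :
    aeval ![a, b] (separant g) ≠ 0 := by
  obtain ⟨Q, rfl⟩ := hPg
  have hQ : aeval ![a, b] Q ≠ 0 := fun h => by
    obtain ⟨R, rfl⟩ := dvd_of_aeval_eq_zero ha hP hP0 h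
    exact hP.not_isUnit (hg P ⟨R, by ring⟩)
  rw [separant, Derivation.leibniz, smul_eq_mul, smul_eq_mul, map_add, map_mul, map_mul, hP0,
    zero_mul, zero_add]
  exact mul_ne_zero hQ (pderiv_one_aeval_ne_zero ha hP hP0)

/-- At `(y, y')` each `B_j` takes the value `y^(j)`, so the associated polynomial vanishes there and
is a multiple of `P`. -/
lemma dvd_assocPoly (D : Derivation ℂ L L) {y : L} (hy : Transcendental ℂ y)
    {P g : MvPolynomial (Fin 2) ℂ} (hP : Irreducible P) (hP0 : aeval ![y, D y] P = 0)
    (hPg : P ∣ g) (hg : Squarefree g) {G : Fin m → MvPolynomial (Fin (m + 1)) ℂ}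
    (hG : ∀ j, aeval (fun i : Fin (m + 1) => D^[i] y) (G j) = 0) (j : Fin m) :
    P ∣ assocPoly g G j := by
  have hg0 : aeval ![y, D y] g = 0 := by
    obtain ⟨Q, rfl⟩ := hPg
    rw [map_mul, hP0, zero_mul]
  refine dvd_of_aeval_eq_zero hy hP hP0 (HasValueAt.aeval_num_eq_zero ?_)
  split_ifs
  · rw [← hg0]
    exact hasValueAt_algebraMap g
  · rw [← hG j]
    exact HasValueAt.aeval (fun i : Fin (m + 1) => hasValueAt_ratB D hg0
      (separant_aeval_ne_zero hy hP hP0 hPg hg) i) (G j)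

end Field

lemma assocPoly_zero_ne_zero [NeZero m] {g : MvPolynomial (Fin 2) ℂ} (hg : g ≠ 0)
    (G : Fin m → MvPolynomial (Fin (m + 1)) ℂ) : assocPoly g G 0 ≠ 0 := by
  rw [assocPoly, if_pos (by simp)]
  intro h
  rw [IsFractionRing.num_eq_zero] at h
  exact hg ((map_eq_zero_iff _ (IsFractionRing.injective _ _)).mp h)

/-- The product of the relevant `f i` is a non-zero common multiple. Degrees can be compared along
`P ∣ H` only when `H` is non-zero. -/
lemma IsLCMOf.ne_zero {ι : Type} [Fintype ι] {p : ι → Prop} {f : ι → MvPolynomial (Fin 2) ℂ}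
    {H : MvPolynomial (Fin 2) ℂ} (hH : IsLCMOf p f H) (hf : ∀ i, p i → f i ≠ 0) : H ≠ 0 := by
  classical
  refine ne_zero_of_dvd_ne_zero (q := ∏ i, if p i then f i else 1) ?_ (hH.2 _ fun i hi => ?_)
  · refine Finset.prod_ne_zero_iff.mpr fun i _ => ?_
    split_ifs with hi
    · exact hf i hi
    · exact one_ne_zero
  · refine dvd_trans ?_ (Finset.dvd_prod_of_mem _ (Finset.mem_univ i))
    rw [if_pos hi]

lemma degreeOf_le_of_dvd {P H : MvPolynomial (Fin 2) ℂ} (hH : H ≠ 0) (h : P ∣ H) (i : Fin 2) :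
    P.degreeOf i ≤ H.degreeOf i := by
  obtain ⟨Q, rfl⟩ := h
  rw [degreeOf_mul_eq (left_ne_zero_of_mul hH) (right_ne_zero_of_mul hH)]
  exact Nat.le_add_right _ _

lemma degreeOf_zero_ne_zero {L : Type*} [Field L] [Algebra ℂ L] {a b : L}
    (hb : Transcendental ℂ b) {F : MvPolynomial (Fin 2) ℂ} (hF : F ≠ 0)
    (h : aeval ![a, b] F = 0) : F.degreeOf 0 ≠ 0 := by
  rw [← degreeOf_one_swapVars]
  refine degreeOf_one_ne_zero (a := b) (b := a) hb ?_ (by rw [aeval_swapVars, h])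
  intro h0
  exact hF ((map_eq_zero_iff _ (renameEquiv ℂ (Equiv.swap (0 : Fin 2) 1)).injective).mp h0)

lemma exists_eq_of_isAlgebraic_derivation {L : Type*} [Field L] [Algebra ℂ L]
    (D : Derivation ℂ L L) (hconst : ∀ z, D z = 0 → ∃ c : ℂ, algebraMap ℂ L c = z) {x y : L}
    (hx : D x = 1) (hy : IsAlgebraic ℂ (D y)) :
    ∃ α β : ℂ, y = algebraMap ℂ L α * x + algebraMap ℂ L β := by
  obtain ⟨α, hα⟩ := isAlgebraic_iff_mem_range.mp hy
  obtain ⟨β, hβ⟩ := hconst (y - algebraMap ℂ L α * x) (by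
    rw [map_sub, Derivation.leibniz, hx, D.map_algebraMap, ← hα, smul_eq_mul, smul_zero, add_zero,
      mul_one, sub_self])
  exact ⟨α, β, by rw [hβ, add_sub_cancel]⟩

lemma transcendental_ddxDer {x₀ : OnePoint ℂ} {y : HahnSeries ℚ ℂ}
    (hy : ∀ a b : ℂ, y ≠ HahnSeries.C a * xSeries x₀ + HahnSeries.C b) :
    Transcendental ℂ (ddxDer x₀ y) := by
  intro h
  obtain ⟨α, β, e⟩ := exists_eq_of_isAlgebraic_derivation (ddxDer x₀)
    (fun _ => exists_eq_C_of_ddxDer_eq_zero x₀) (ddxDer_xSeries x₀) h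
  exact hy α β (by rwa [algebraMap_hahnSeries_apply, algebraMap_hahnSeries_apply] at e)

/-- The minimal polynomial of a solution with respect to its derivative divides every reduced
differential equation. -/
lemma IsReducedEquation.exists_dvd [NeZero m] {S : Set (MvPolynomial (Fin (m + 1)) ℂ)}
    (hdim : dimension S = 1) {strip : Bool} {H : MvPolynomial (Fin 2) ℂ}
    (hH : IsReducedEquation strip S H) {x₀ : OnePoint ℂ} {y : HahnSeries ℚ ℂ}
    (hsol : IsSolution S x₀ y) (hnonconst : ∀ c : ℂ, y ≠ HahnSeries.C c)
    (hnonlin : strip = true → ∀ a b : ℂ, y ≠ HahnSeries.C a * xSeries x₀ + HahnSeries.C b) :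
    H ≠ 0 ∧ ∃ P, Irreducible P ∧ P ∣ H ∧ aeval ![y, ddxDer x₀ y] P = 0 := by
  obtain ⟨N, T, h, hT, hred, hlcm⟩ := hH
  refine ⟨hlcm.ne_zero fun k hk => ?_, ?_⟩
  · obtain ⟨G, hG⟩ := hk
    obtain ⟨g, hg, hgcd⟩ := hred k G hG
    exact ne_zero_of_dvd_ne_zero (assocPoly_zero_ne_zero hg.1.ne_zero G) (hgcd.1 0)
  have hy : Transcendental ℂ y := transcendental_of_derivation_ne_zero _ (ddx_ne_zero x₀ hnonconst)
  let a : Fin (m + 1) → HahnSeries ℚ ℂ := fun i => (ddxDer x₀)^[i] y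
  have ha : a ∈ zeroSet (HahnSeries ℚ ℂ) S := by
    intro F hF
    have h1 := hsol F hF
    have h2 : ddx x₀ = ddxDer x₀ := funext fun z => (ddxDer_apply x₀ z).symm
    rwa [h2] at h1
  -- The decomposition is applied over the field of Hahn series, to the point formed by the solution
  -- and its derivatives.
  rw [hT.2, Set.mem_iUnion] at ha
  obtain ⟨k, hk, -⟩ := ha
  have h0 : ∀ F ∈ T k, lv F ≠ 0 := fun F hF =>
    lv_ne_zero_of_transcendental (a := a) hy ((hT.1 k).nonconstant F hF) (hk F hF)
  obtain ⟨G, hG⟩ := (hT.1 k).exists_isODEChain h0 fun j hj => hT.exists_lv_eq hdim k hj.symm h0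
  obtain ⟨g, hg, hgcd⟩ := hred k G hG
  have hGa : ∀ j, aeval a (G j) = 0 := fun j => hk (G j) (by
    rw [hG.1, Set.mem_ofPred_eq, List.mem_ofFn]
    exact ⟨j, rfl⟩)
  have hlv : lv (G 0) ≤ 1 := by
    rw [(hG.2 0).2, Fin.succ_zero_eq_one']
  have hG0 : G 0 ≠ 0 := fun e => by
    have := (hG.2 0).1
    rw [e] at this
    simp at this
  have ha1 : a 1 = ddxDer x₀ y := by
    have h1 : ((1 : Fin (m + 1)) : ℕ) = 1 := by
      rw [Fin.val_one', Nat.mod_eq_of_lt]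
      have := NeZero.pos m
      omega
    change (ddxDer x₀)^[((1 : Fin (m + 1)) : ℕ)] y = _
    rw [h1]
    rfl
  obtain ⟨P, hP, hPG, hP0⟩ := exists_irreducible_dvd (a := y) (b := ddxDer x₀ y)
    (toBiv_ne_zero hlv hG0) (by rw [← hGa 0, ← aeval_toBiv hlv a, ha1]; rfl)
  refine ⟨P, hP, ?_, hP0⟩
  -- `P` is not among the removed factors: a factor in `ℂ[u₀]` would make `y` algebraic over `ℂ`,
  -- one in `ℂ[u₁]` would make `y'` algebraic and `y` linear in `x`.
  have hPg : P ∣ g := (hg.2 P hP).mpr ⟨hPG, degreeOf_one_ne_zero hy hP.ne_zero hP0,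
    fun hs => degreeOf_zero_ne_zero (transcendental_ddxDer (hnonlin hs)) hP.ne_zero hP0⟩
  exact (hgcd.2 P fun j => dvd_assocPoly (ddxDer x₀) hy hP hP0 hPg hg.1 hGa j).trans
    (hlcm.1 k ⟨G, hG⟩)

end AutonomousODE

end

theorem mainTheorem4 (m : ℕ) [NeZero m] (M : ℕ) (F : Fin M → MvPolynomial (Fin (m + 1)) ℂ)
    (hdim : AutonomousODE.dimension (Set.range F) = 1)
    (strip : Bool) (H : MvPolynomial (Fin 2) ℂ)
    (hH : AutonomousODE.IsReducedEquation strip (Set.range F) H)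
    (x₀ : OnePoint ℂ) (y : HahnSeries ℚ ℂ) (hy : AutonomousODE.IsPuiseux y)
    (hsol : AutonomousODE.IsSolution (Set.range F) x₀ y)
    (hnonconst : ∀ c : ℂ, y ≠ HahnSeries.C c)
    (hnonlin : strip = true →
      ∀ a b : ℂ, y ≠ HahnSeries.C a * AutonomousODE.xSeries x₀ + HahnSeries.C b)
    (halg : AutonomousODE.IsAlgebraicSeries x₀ y) :
    (∃ G, AutonomousODE.IsMinimalPolynomial x₀ y G) ∧
    (∀ G, AutonomousODE.IsMinimalPolynomial x₀ y G →
      G.degreeOf 0 ≤ H.degreeOf 1 ∧ G.degreeOf 1 ≤ H.degreeOf 0 + H.degreeOf 1) ∧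
    (∀ r : RatFunc ℂ, AutonomousODE.IsExpansionOf x₀ y r →
      max r.num.natDegree r.denom.natDegree ≤ H.degreeOf 1) := by
  obtain ⟨hH0, P, hP, hPH, hPy⟩ := hH.exists_dvd hdim hsol hnonconst hnonlin
  have hdeg := AutonomousODE.degreeOf_le_of_dvd hH0 hPH
  have key : ∀ G, AutonomousODE.IsMinimalPolynomial x₀ y G →
      G.degreeOf 0 ≤ H.degreeOf 1 ∧ G.degreeOf 1 ≤ H.degreeOf 0 + H.degreeOf 1 := by
    intro G hG
    obtain ⟨h1, h2⟩ := hG.degree_bounds (AutonomousODE.ddx_ne_zero x₀ hnonconst) hP hPy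
    exact ⟨h1.trans_le (hdeg 1), h2.trans (add_le_add (hdeg 0) (hdeg 1))⟩
  refine ⟨AutonomousODE.exists_isMinimalPolynomial halg, key, fun r hr => ?_⟩
  obtain ⟨G, hG, hle⟩ := hr.exists_isMinimalPolynomial
  exact hle.trans (key G hG).1
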